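/- **Setting.** A payment network is a finite simple graph $G=(V,E)$ with $|V|=n+1$ and capacities $c:E\to\mathbb R_{\ge 0}$ such that the edges of positive capacity connect $V$. An escrow configuration is a map $w\ge 0$ on ordered pairs of adjacent vertices with $w(u,v)+w(v,u)=c(\{u,v\})$. A transaction of size $k\ge 0$ from $x$ to $y$ succeeds in $w$ if there is a flow $f\ge 0$ carrying $k$ units from $x$ to $y$ with $f_{(u,v)}\le w(u,v)$ for all $(u,v)$. Fix an orientation, i.e. signs $s(u,v)=-s(v,u)\in\{\pm1\}$ on ordered pairs of adjacent vertices, and a spanning representation $D:E\to\mathbb R^n$: the direction $D(p)=\sum_i s(v_i,v_{i+1})D(\{v_i,v_{i+1}\})$ of a walk $p=(v_0,\dots,v_t)$ is $0$ if and only if $v_0=v_t$, and for every spanning tree $T$ the vectors $D(e)$, $e\in T$, span $\mathbb R^n$. The score of a configuration is $S(w)=\sum_{s(u,v)=1}w(u,v)D(\{u,v\})$, and $Z\subset\mathbb R^n$ is the set of all scores. Probabilities of sets of configurations are measured by the uniform (normalized Lebesgue) measure of their images in $Z$. The transaction of size $k$ from $x$ to $y$ corresponds to the vector $v=kD(p)$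 for a walk $p$ from $x$ to $y$, and its liquidity is the probability that a uniform $z\in Z$ satisfies $z-v\in Z$. For a finite multigraph and edge weights $a$, let $\Gamma(a)=\sum_T\prod_{e\in T}a_e$, summed over spanning trees $T$, and $\Gamma_e(a)=\sum_S\prod_{b\in S}a_b$, summed over the edge sets $S\not\ni e$ such that $S\cup\{e\}$ is a spanning tree. **Statement.** Let $e=\{x,y\}\in E$ and $0\le k\le c(e)$, and let $v$ correspond to the transaction of size $k$ from $x$ to $y$. Then the uniform probability measure on $Z$ is well defined, $\Gamma(c)>0$, and the probability that the transaction fails (the measure of the image of the set of configurations in which it fails) equals one minus its liquidity. Moreover: 1. The failure probability is $$\frac{k\,\Gamma_e(c)}{\Gamma(c)} .$$ It also equals $k\,R$, where $R$ is the effective resistance between $x$ and $y$ in the electrical network in which each edge $a$ has conductance $c(a)$. That is, $R=\varphi(x)-\varphi(y)$ for any potential $\varphi:V\to\mathbb R$ such that $\sum_{b\sim u}c(\{u,b\})(\varphi(u)-\varphi(b))=\mathbf 1_{u=x}-\mathbf 1_{u=y}$ for all $u\in V$; such $\varphi$ exists and $R$ does not depend on the choice. 2. Let $G'$ be the multigraph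 obtained from $G$ by replacing $e$ by two parallel edges $f_1,f_2$ with $c'(f_1)=k$, $c'(f_2)=c(e)-k$, and $c'(a)=c(a)$ for all other edges $a$. Then $\Gamma(c')>0$ for the multigraph $G'$, and the failure probability equals the probability that $f_1$ belongs to a random spanning tree of $G'$ drawn with probability proportional to $\prod_{a\in T}c'(a)$. -/

import Mathlib

namespace PaymentNetwork

section Trees

/-! Finite multigraphs on the vertex set `V`, given by a type `E` of edges and the map `ends`
sending an edge to its unordered pair of endpoints. -/

variable {V E : Type*}

/-- The edge set `T` is (the edge set of) a spanning tree of the multigraph `(V, E, ends)`: it has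
no loops and no two parallel edges, and the simple graph on all of `V` formed by its edges is a
tree. -/
def IsSpanningTree (ends : E → Sym2 V) (T : Finset E) : Prop :=
  (∀ e ∈ T, ¬ (ends e).IsDiag) ∧ Set.InjOn ends (T : Set E) ∧
    (SimpleGraph.fromEdgeSet (ends '' (T : Set E))).IsTree

variable [Fintype E]

open Classical in
/-- The generating polynomial `Γ(y) = ∑_T ∏_{e ∈ T} y_e` of the spanning trees. -/
noncomputable def treeGen (ends : E → Sym2 V) (y : E → ℝ) : ℝ :=
  ∑ T : Finset E with IsSpanningTree ends T, ∏ e ∈ T, y e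

open Classical in
/-- `Γ_e(y)`: the sum of `∏_{a ∈ S} y_a` over the edge sets `S` not containing `e` such that
`S ∪ {e}` is a spanning tree. -/
noncomputable def treeGenAt (ends : E → Sym2 V) (e : E) (y : E → ℝ) : ℝ :=
  ∑ S : Finset E with e ∉ S ∧ IsSpanningTree ends (insert e S), ∏ a ∈ S, y a

open Classical in
/-- The probability that the edge `f` lies in a random spanning tree `T`, where `T` is drawn with
probability proportional to `∏_{e ∈ T} y_e`. -/
noncomputable def randomTreeProb (ends : E → Sym2 V) (y : E → ℝ) (f : E) : ℝ :=
  (∑ T : Finset E with IsSpanningTree ends T ∧ f ∈ T, ∏ e ∈ T, y e) /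
    ∑ T : Finset E with IsSpanningTree ends T, ∏ e ∈ T, y e

end Trees

variable {V : Type*} (G : SimpleGraph V)

/-- The endpoints of the edges of a simple graph, viewed as a multigraph. -/
def edgeEnds (e : G.edgeSet) : Sym2 V := e.1

/-- The multigraph obtained from `G` by duplicating the edge `e` into `f₁ = none` and
`f₂ = some e`; every other edge `a` is kept as `some a`. -/
def splitEnds (e : G.edgeSet) : Option G.edgeSet → Sym2 V
  | none => e.1
  | some a => a.1

open Classical in
/-- The capacities on the multigraph `splitEnds G e`: capacity `k` on `f₁`, capacity `c e - k`
on `f₂`, and the old capacity on every other edge. -/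
noncomputable def splitCapacity (c : G.edgeSet → ℝ) (e : G.edgeSet) (k : ℝ) :
    Option G.edgeSet → ℝ
  | none => k
  | some a => if a = e then c e - k else c a

variable {G}

/-- The undirected edge underlying an ordered pair `d = (u, v)` of adjacent vertices. -/
def dartEdge (d : G.Dart) : G.edgeSet := ⟨d.edge, d.edge_mem⟩

/-- An escrow configuration for the capacities `c`: `w (u, v) ≥ 0` is the amount owned by `u` on
the edge `{u, v}`, and `w (u, v) + w (v, u) = c {u, v}`. -/
def IsConfiguration (c : G.edgeSet → ℝ) (w : G.Dart → ℝ) : Prop :=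
  (∀ d, 0 ≤ w d) ∧ ∀ d, w d + w d.symm = c (dartEdge d)

/-- An orientation: a sign on the ordered pairs of adjacent vertices, opposite on `(u, v)` and
`(v, u)`. -/
def IsOrientation (o : G.Dart → ℤˣ) : Prop :=
  ∀ d, o d.symm = - o d

/-- The direction of a walk: the signed sum of `D` along it. -/
def walkDirection {n : ℕ} (o : G.Dart → ℤˣ) (D : G.edgeSet → Fin n → ℝ) {u v : V}
    (p : G.Walk u v) : Fin n → ℝ :=
  (p.darts.map fun d => ((o d : ℤ) : ℝ) • D (dartEdge d)).sum

/-- Spanning representations: a walk has direction `0` exactly if it is closed, and the directions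
of the edges of any spanning tree span `ℝⁿ`. -/
def IsSpanningRepresentation {n : ℕ} (o : G.Dart → ℤˣ) (D : G.edgeSet → Fin n → ℝ) : Prop :=
  (∀ (u v : V) (p : G.Walk u v), walkDirection o D p = 0 ↔ u = v) ∧
    ∀ T : Finset G.edgeSet, IsSpanningTree (edgeEnds G) T →
      Submodule.span ℝ (D '' (T : Set G.edgeSet)) = ⊤

/-- The vector `v` corresponds to the transaction of size `k` from `x` to `y`. -/
def CorrespondsTo {n : ℕ} (o : G.Dart → ℤˣ) (D : G.edgeSet → Fin n → ℝ) (x y : V) (k : ℝ)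
    (v : Fin n → ℝ) : Prop :=
  ∃ p : G.Walk x y, v = k • walkDirection o D p

section Finite

variable [Fintype V] [DecidableEq V] [DecidableRel G.Adj]

/-- The transaction of size `k` from `x` to `y` succeeds in the configuration `w`: some flow `f`
takes `k` units from `x` to `y` and uses at most `w (u, v)` on each ordered pair `(u, v)`. -/
def Succeeds (w : G.Dart → ℝ) (x y : V) (k : ℝ) : Prop :=
  ∃ f : G.Dart → ℝ, (∀ d, 0 ≤ f d ∧ f d ≤ w d) ∧
    ∀ u : V, ((∑ d : G.Dart with d.fst = u, f d) - ∑ d : G.Dart with d.snd = u, f d) =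
      (if u = x then k else 0) - (if u = y then k else 0)

variable {n : ℕ}

/-- The represented score of a configuration: the sum of `w (u, v) D (u, v)` over the positively
oriented pairs. -/
def score (o : G.Dart → ℤˣ) (D : G.edgeSet → Fin n → ℝ) (w : G.Dart → ℝ) : Fin n → ℝ :=
  ∑ d : G.Dart with o d = 1, w d • D (dartEdge d)

/-- The image in `ℝⁿ` of the set of all configurations. -/
def stateSpace (o : G.Dart → ℤˣ) (D : G.edgeSet → Fin n → ℝ) (c : G.edgeSet → ℝ) :
    Set (Fin n → ℝ) :=
  score o D '' {w | IsConfiguration c w}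

/-- The uniform distribution on the state space: normalized Lebesgue measure. -/
noncomputable def uniformState (o : G.Dart → ℤˣ) (D : G.edgeSet → Fin n → ℝ)
    (c : G.edgeSet → ℝ) : MeasureTheory.Measure (Fin n → ℝ) :=
  ProbabilityTheory.cond MeasureTheory.volume (stateSpace o D c)

/-- The probability, under the uniform distribution on states, that the transaction of size `k`
from `x` to `y` fails: the measure of the image of the set of configurations where it fails. -/
noncomputable def failureProb (o : G.Dart → ℤˣ) (D : G.edgeSet → Fin n → ℝ)
    (c : G.edgeSet → ℝ) (x y : V) (k : ℝ) : ℝ :=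
  (uniformState o D c).real (score o D '' {w | IsConfiguration c w ∧ ¬ Succeeds w x y k})

/-- The liquidity with regard to the transaction vector `v`: the probability that a uniform state
`z` satisfies `z - v ∈ Z`, where `Z` is the state space. -/
noncomputable def liquidity (o : G.Dart → ℤˣ) (D : G.edgeSet → Fin n → ℝ)
    (c : G.edgeSet → ℝ) (v : Fin n → ℝ) : ℝ :=
  (uniformState o D c).real {z | z - v ∈ stateSpace o D c}

/-- `R` is the effective resistance between `x` and `y` in the electrical network in which the
edge `e` has conductance `c e`: there are potentials `φ` for which the current is conserved except
that one unit enters at `x` and leaves at `y`, and `R` is the potential difference `φ x - φ y`. -/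
def IsEffectiveResistance (c : G.edgeSet → ℝ) (x y : V) (R : ℝ) : Prop :=
  ∃ φ : V → ℝ,
    (∀ u : V, ∑ d : G.Dart with d.fst = u, c (dartEdge d) * (φ d.fst - φ d.snd) =
      (if u = x then 1 else 0) - (if u = y then 1 else 0)) ∧
    R = φ x - φ y

end Finite

end PaymentNetwork

open PaymentNetwork

/-! Closed walks have direction zero, so the vertices can be placed at points `b u` of ℝⁿ with each
`D e` equal, up to sign, to the difference of the endpoints of `e`; the spanning condition makes
these n + 1 points an affine basis (`exists_isPlacement`). The state space Z is then the zonotope ∑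
[0, c e] D e, and a function on darts is a flow exactly if its total displacement is right
(`flow_iff`). Hence a payment fails exactly if it moves the score out of Z.

For an edge e the payment vector is v = ±k D e. Since Z is a convex body swept along D e, the
overlap of Z and Z + v is a translate of the zonotope with c e lowered by k.

The volume of a zonotope is affine in each capacity and homogeneous of degree n, so its values at
indicators of n-element sets determine it. These are |det| of n vectors D e: zero unless the edges
form a spanning tree, and one constant κ for all trees, because two tree bases differ by an integral
matrix with integral inverse. So vol = κ Γ, and the overlap has volume κ(Γ - k Γ_e).

The same argument gives det = κ² Γ for the Gram matrix ∑ c e D e D eᵀ, which is the Laplacian in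
these coordinates. Raising c e by 1 and applying the matrix determinant lemma identifies Γ_e / Γ
with the effective resistance. Splitting e preserves Γ, and Γ at f₁ equals Γ_e. -/

namespace PaymentNetwork

open MeasureTheory Finset

/-! ### Additive and multi-affine functions on the nonnegative orthant -/

section MultiAffine

/-- An additive nonnegative function on the nonnegative reals is linear. -/
lemma eq_mul_of_additive_of_nonneg {h : ℝ → ℝ}
    (hadd : ∀ s t, 0 ≤ s → 0 ≤ t → h (s + t) = h s + h t) (hpos : ∀ t, 0 ≤ t → 0 ≤ h t)
    {t : ℝ} (ht : 0 ≤ t) : h t = t * h 1 := by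
  have h0 : h 0 = 0 := by simpa using hadd 0 0 le_rfl le_rfl
  have hmul : ∀ (m : ℕ) (x : ℝ), 0 ≤ x → h (m * x) = m * h x := by
    intro m x hx
    induction m with
    | zero => simp [h0]
    | succ m ih =>
      have := hadd (m * x) x (by positivity) hx
      push_cast
      rw [add_mul, one_mul, this, ih]; ring
  have hmono : ∀ s t, 0 ≤ s → s ≤ t → h s ≤ h t := by
    intro s t hs hst
    have := hadd s (t - s) hs (by linarith)
    have h2 := hpos (t - s) (by linarith)
    rw [add_sub_cancel] at this
    linarith
  have h1 : 0 ≤ h 1 := hpos 1 zero_le_one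
  -- Both m * h t and m * t * h 1 lie between ⌊m t⌋ * h 1 and (⌊m t⌋ + 1) * h 1, so they differ by
  -- at most h 1 for every m.
  have key : ∀ m : ℕ, m * |h t - t * h 1| ≤ h 1 := by
    intro m
    have hmt : 0 ≤ (m : ℝ) * t := by positivity
    have a1 := Nat.floor_le hmt
    have a2 := (Nat.lt_floor_add_one ((m : ℝ) * t)).le
    have b1 := hmono _ _ (by positivity) a1
    have b2 := hmono _ _ hmt a2
    have e1 := hmul ⌊(m : ℝ) * t⌋₊ 1 zero_le_one
    have e2 := hmul (⌊(m : ℝ) * t⌋₊ + 1) 1 zero_le_one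
    push_cast at e2
    rw [mul_one] at e1 e2
    rw [hmul m t ht] at b1 b2
    rw [e1] at b1
    rw [e2] at b2
    rw [← abs_of_nonneg (Nat.cast_nonneg (α := ℝ) m), ← abs_mul, abs_le]
    constructor <;> nlinarith
  by_contra hne
  have hp : 0 < |h t - t * h 1| := abs_pos.2 (sub_ne_zero.2 hne)
  obtain ⟨m, hm⟩ := exists_nat_gt (h 1 / |h t - t * h 1|)
  rw [div_lt_iff₀ hp] at hm
  linarith [key m]

variable {E : Type*} [DecidableEq E]

/-- Induction on the set U of free coordinates, the others being frozen at `b`. Freeing `e` uses the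
expansions with `e` frozen at 0 and at 1, so `b` has to vary in the induction. -/
lemma exists_sum_powerset_of_multiaffine {f : (E → ℝ) → ℝ}
    (hf : ∀ c, 0 ≤ c → ∀ e t, 0 ≤ t → f (Function.update c e t) =
      f (Function.update c e 0) + t * (f (Function.update c e 1) - f (Function.update c e 0)))
    (U : Finset E) : ∀ b : E → ℝ, 0 ≤ b → ∃ a : Finset E → ℝ, ∀ c, 0 ≤ c →
      f (U.piecewise c b) = ∑ S ∈ U.powerset, a S * ∏ e ∈ S, c e := by
  induction U using Finset.induction_on with
  | empty => exact fun b _ => ⟨fun _ => f b, fun c _ => by simp⟩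
  | insert e U he ih =>
    intro b hb
    have hb0 : 0 ≤ Function.update b e 0 := by
      intro i; by_cases h : i = e <;> simp [h]; exact hb i
    have hb1 : 0 ≤ Function.update b e 1 := by
      intro i; by_cases h : i = e <;> simp [h]; exact hb i
    obtain ⟨a0, h0⟩ := ih _ hb0
    obtain ⟨a1, h1⟩ := ih _ hb1
    refine ⟨fun S => if e ∈ S then a1 (S.erase e) - a0 (S.erase e) else a0 S, fun c hc => ?_⟩
    have key : ∀ t, Function.update (U.piecewise c b) e t =
        U.piecewise c (Function.update b e t) := by
      intro t; ext i
      by_cases h : i = e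
      · subst h; simp [Finset.piecewise, he]
      · simp [Finset.piecewise, h]
    have hnn : 0 ≤ U.piecewise c b := by
      intro i; by_cases h : i ∈ U <;> simp [Finset.piecewise, h]
      · exact hc i
      · exact hb i
    have e1 : (insert e U).piecewise c b = Function.update (U.piecewise c b) e (c e) := by
      rw [Finset.piecewise_insert]
    rw [e1, hf _ hnn e _ (hc e), key, key, h0 c hc, h1 c hc, Finset.sum_powerset_insert he]
    have s1 : ∑ S ∈ U.powerset, (if e ∈ S then a1 (S.erase e) - a0 (S.erase e) else a0 S) *
        ∏ e ∈ S, c e = ∑ S ∈ U.powerset, a0 S * ∏ e ∈ S, c e := by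
      refine Finset.sum_congr rfl fun S hS => ?_
      rw [if_neg fun h => he (Finset.mem_powerset.1 hS h)]
    have s2 : ∑ S ∈ U.powerset, (if e ∈ insert e S then a1 ((insert e S).erase e) -
        a0 ((insert e S).erase e) else a0 (insert e S)) * ∏ i ∈ insert e S, c i =
        c e * ∑ S ∈ U.powerset, (a1 S - a0 S) * ∏ e ∈ S, c e := by
      rw [Finset.mul_sum]
      refine Finset.sum_congr rfl fun S hS => ?_
      have heS : e ∉ S := fun h => he (Finset.mem_powerset.1 hS h)
      rw [if_pos (Finset.mem_insert_self _ _), Finset.erase_insert heS, Finset.prod_insert heS]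
      ring
    rw [s1, s2, ← Finset.sum_sub_distrib]
    simp only [sub_mul]

open Polynomial in
/-- A function that is affine in each nonnegative coordinate and homogeneous of degree `n` is a
combination of the squarefree monomials of degree `n`; its coefficients are its values at indicator
vectors. -/
theorem eq_sum_of_multiaffine_of_homogeneous [Fintype E] {n : ℕ} {f : (E → ℝ) → ℝ}
    (hf : ∀ c, 0 ≤ c → ∀ e t, 0 ≤ t → f (Function.update c e t) =
      f (Function.update c e 0) + t * (f (Function.update c e 1) - f (Function.update c e 0)))
    (hhom : ∀ c, 0 ≤ c → ∀ t : ℝ, 0 ≤ t → f (t • c) = t ^ n * f c) {c : E → ℝ} (hc : 0 ≤ c) :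
    f c = ∑ S ∈ (univ : Finset E).powersetCard n, f (Set.indicator S 1) * ∏ e ∈ S, c e := by
  obtain ⟨a, ha⟩ := exists_sum_powerset_of_multiaffine hf univ 0 le_rfl
  simp only [Finset.piecewise_univ, Finset.powerset_univ] at ha
  have hn : ∀ c, 0 ≤ c → f c = ∑ S ∈ (univ : Finset E).powersetCard n, a S * ∏ e ∈ S, c e := by
    intro c hc
    -- For fixed c both sides are polynomials in the scaling factor t that agree for all t ≥ 0; the
    -- coefficient of tⁿ keeps only the sets of size n.
    let p : ℝ[X] := ∑ S : Finset E, C (a S * ∏ e ∈ S, c e) * X ^ S.card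
    let q : ℝ[X] := C (f c) * X ^ n
    have hpq : p = q := by
      refine Polynomial.eq_of_infinite_eval_eq p q ((Set.Ici_infinite (0 : ℝ)).mono ?_)
      intro t (ht : 0 ≤ t)
      have h1 := hhom c hc t ht
      rw [ha (t • c) (smul_nonneg ht hc)] at h1
      simp only [Set.mem_ofPred_eq, p, q, eval_finsetSum, eval_mul, eval_C, eval_pow, eval_X]
      rw [mul_comm (f c), ← h1]
      refine Finset.sum_congr rfl fun S _ => ?_
      simp only [Pi.smul_apply, smul_eq_mul, Finset.prod_mul_distrib, Finset.prod_const]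
      ring
    have := congrArg (fun r => r.coeff n) hpq
    simp only [p, q, finsetSum_coeff, coeff_C_mul, coeff_X_pow, if_true, mul_ite, mul_one,
      mul_zero] at this
    rw [← this, Finset.sum_ite, Finset.sum_const_zero, add_zero]
    refine Finset.sum_congr ?_ fun _ _ => rfl
    ext S; simp [Finset.mem_powersetCard, eq_comm]
  rw [hn c hc]
  refine Finset.sum_congr rfl fun S hS => ?_
  congr 1
  -- At the indicator of S only the monomial of S survives: any other n-element set has an element
  -- outside S.
  rw [hn (Set.indicator S 1) (Set.indicator_nonneg fun _ _ => zero_le_one)]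
  have hcard := (Finset.mem_powersetCard.1 hS).2
  rw [Finset.sum_eq_single_of_mem S hS]
  · rw [Finset.prod_congr rfl (fun e he => Set.indicator_of_mem (Finset.mem_coe.2 he) _)]
    simp
  · intro T hT hTS
    have : ∃ e ∈ T, e ∉ S := by
      by_contra! hcon
      exact hTS (Finset.eq_of_subset_of_card_le hcon
        (by rw [hcard, (Finset.mem_powersetCard.1 hT).2]))
    obtain ⟨e, heT, heS⟩ := this
    rw [Finset.prod_eq_zero heT (Set.indicator_of_notMem (by simpa using heS) _), mul_zero]

end MultiAffine

/-! ### Sweeping a convex set along a segment -/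

section Sweep

open Pointwise

variable {F : Type*} [AddCommGroup F] [Module ℝ F]

/-- The union of the translates of `K` by `s • u` for `0 ≤ s ≤ t`. -/
def sweep (K : Set F) (u : F) (t : ℝ) : Set F :=
  {z | ∃ s ∈ Set.Icc 0 t, z - s • u ∈ K}

lemma sweep_zero (K : Set F) (u : F) : sweep K u 0 = K := by
  ext z; simp [sweep]

/-- The parameters r with z - r • u in K form an interval, being the preimage of a convex set under
an affine map. -/
lemma sub_smul_mem_of_convex {K : Set F} (hK : Convex ℝ K) {z u : F} {p q r : ℝ}
    (hp : z - p • u ∈ K) (hq : z - q • u ∈ K) (hpr : p ≤ r) (hrq : r ≤ q) : z - r • u ∈ K := by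
  rcases hpr.eq_or_lt with rfl | hpr
  · exact hp
  have hpq : 0 < q - p := by linarith
  have := hK hp hq (a := (q - r) / (q - p)) (b := (r - p) / (q - p))
    (div_nonneg (by linarith) hpq.le) (div_nonneg (by linarith) hpq.le)
    (by rw [← add_div]; exact (div_eq_one_iff_eq hpq.ne').2 (by ring))
  convert this using 1
  match_scalars <;> field_simp <;> ring

/-- Lengthening a sweep by `s` adds a translate of what a sweep of length `s` adds. -/
lemma sweep_add_diff {K : Set F} (hK : Convex ℝ K) (u : F) {t s : ℝ} (ht : 0 ≤ t) :
    sweep K u (t + s) \ sweep K u t = (fun z => t • u + z) '' (sweep K u s \ K) := by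
  rw [Set.image_add_left]
  ext z
  simp only [sweep, Set.mem_sdiff, Set.mem_ofPred_eq, Set.mem_Icc, Set.mem_preimage]
  constructor
  · rintro ⟨⟨r, ⟨hr0, hr⟩, hz⟩, hnot⟩
    have htr : t < r := by
      by_contra! h
      exact hnot ⟨r, ⟨hr0, h⟩, hz⟩
    refine ⟨⟨r - t, ⟨by linarith, by linarith⟩, ?_⟩, fun h => hnot ⟨t, ⟨ht, le_rfl⟩, ?_⟩⟩
    · convert hz using 1; module
    · convert h using 1; module
  · rintro ⟨⟨r, ⟨hr0, hr⟩, hz⟩, hnot⟩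
    have hz' : z - (t + r) • u ∈ K := by convert hz using 1; module
    have hnot' : z - t • u ∉ K := fun h => hnot (by convert h using 1; module)
    refine ⟨⟨t + r, ⟨by linarith, by linarith⟩, hz'⟩, ?_⟩
    rintro ⟨q, ⟨hq0, hq⟩, hq'⟩
    exact hnot' (sub_smul_mem_of_convex hK hq' hz' hq (by linarith))

/-- A sweep of length `t` meets its translate by `k • u` in the translate of a sweep of length
`t - k`. -/
lemma sweep_inter_translate {K : Set F} (hK : Convex ℝ K) (u : F) {t k : ℝ} (hk : 0 ≤ k)
    (hkt : k ≤ t) :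
    {z | z ∈ sweep K u t ∧ z - k • u ∈ sweep K u t} =
      (fun z => k • u + z) '' sweep K u (t - k) := by
  rw [Set.image_add_left]
  ext z
  simp only [sweep, Set.mem_ofPred_eq, Set.mem_Icc, Set.mem_preimage]
  constructor
  · rintro ⟨⟨s, ⟨hs0, hs⟩, hz⟩, ⟨r, ⟨hr0, hr⟩, hz'⟩⟩
    have hz2 : z - (k + r) • u ∈ K := by convert hz' using 1; module
    by_cases h1 : k ≤ s
    · refine ⟨s - k, ⟨by linarith, by linarith⟩, ?_⟩
      convert hz using 1; module
    by_cases h2 : k + r ≤ t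
    · refine ⟨r, ⟨by linarith, by linarith⟩, ?_⟩
      convert hz2 using 1; module
    -- Now s < k and t < k + r, so k lies between two parameters that put z into K and z - k • u is
    -- itself in K.
    refine ⟨0, ⟨by linarith, by linarith⟩, ?_⟩
    convert sub_smul_mem_of_convex hK hz hz2 (r := k) (by linarith) (by linarith) using 1
    module
  · rintro ⟨r, ⟨hr0, hr⟩, hz⟩
    refine ⟨⟨k + r, ⟨by linarith, by linarith⟩, ?_⟩, ⟨r, ⟨by linarith, by linarith⟩, ?_⟩⟩
    · convert hz using 1; module
    · convert hz using 1; module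

end Sweep

/-! ### Volume of a sweep -/

section SweepVolume

variable {n : ℕ}

lemma isCompact_sweep {K : Set (Fin n → ℝ)} (hK : IsCompact K) (u : Fin n → ℝ) (t : ℝ) :
    IsCompact (sweep K u t) := by
  have : sweep K u t =
      (fun p : ℝ × (Fin n → ℝ) => p.1 • u + p.2) '' (Set.Icc 0 t ×ˢ K) := by
    ext z
    simp only [sweep, Set.mem_ofPred_eq, Set.mem_image, Set.mem_prod, Prod.exists]
    constructor
    · rintro ⟨s, hs, hz⟩
      exact ⟨s, _, ⟨hs, hz⟩, by module⟩
    · rintro ⟨s, y, ⟨hs, hy⟩, rfl⟩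
      exact ⟨s, hs, by simpa using hy⟩
  rw [this]
  exact (isCompact_Icc.prod hK).image (by fun_prop)

/-- The volume swept by a convex body is affine in the length of the sweep. -/
theorem volume_sweep {K : Set (Fin n → ℝ)} (hK : IsCompact K) (hconv : Convex ℝ K)
    (u : Fin n → ℝ) {t : ℝ} (ht : 0 ≤ t) :
    volume.real (sweep K u t) =
      volume.real K + t * (volume.real (sweep K u 1) - volume.real K) := by
  have hmono : ∀ s t, s ≤ t → sweep K u s ⊆ sweep K u t :=
    fun s t hst z ⟨r, hr, hz⟩ => ⟨r, ⟨hr.1, hr.2.trans hst⟩, hz⟩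
  have hdiff : ∀ s t, s ≤ t → volume.real (sweep K u t) =
      volume.real (sweep K u s) + volume.real (sweep K u t \ sweep K u s) := by
    intro s t hst
    rw [measureReal_sdiff (hmono s t hst) (isCompact_sweep hK u s).measurableSet
      (isCompact_sweep hK u t).measure_ne_top]
    ring
  -- By `sweep_add_diff` and translation invariance, the gain in volume depends only on the added
  -- length.
  have hadd : ∀ s t, 0 ≤ s → 0 ≤ t → volume.real (sweep K u (s + t)) - volume.real K =
      (volume.real (sweep K u s) - volume.real K) +
        (volume.real (sweep K u t) - volume.real K) := by
    intro s t hs ht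
    rw [hdiff s (s + t) (by linarith), sweep_add_diff hconv u hs, hdiff 0 t ht, sweep_zero]
    simp only [Measure.real, Set.image_add_left, measure_preimage_add]
    ring
  have hpos : ∀ t, 0 ≤ t → 0 ≤ volume.real (sweep K u t) - volume.real K := by
    intro t ht
    rw [hdiff 0 t ht, sweep_zero]
    simp
  have := eq_mul_of_additive_of_nonneg hadd hpos ht
  linarith

end SweepVolume

/-! ### Zonotopes and their volume -/

section Zonotope

variable {n : ℕ} {E : Type*} [Fintype E]

/-- The zonotope `∑ₑ [0, cₑ] Dₑ`. -/
def zonotope (D : E → Fin n → ℝ) (c : E → ℝ) : Set (Fin n → ℝ) :=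
  (fun t : E → ℝ => ∑ e, t e • D e) '' Set.Icc 0 c

lemma isCompact_zonotope (D : E → Fin n → ℝ) (c : E → ℝ) : IsCompact (zonotope D c) :=
  isCompact_Icc.image (by fun_prop)

lemma convex_zonotope (D : E → Fin n → ℝ) (c : E → ℝ) : Convex ℝ (zonotope D c) :=
  (convex_Icc 0 c).is_linear_image (IsLinearMap.mk
    (fun x y => by simp [add_smul, Finset.sum_add_distrib])
    (fun r x => by simp [mul_smul, Finset.smul_sum]))

lemma zonotope_smul (D : E → Fin n → ℝ) (c : E → ℝ) {t : ℝ} (ht : 0 < t) :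
    zonotope D (t • c) = (fun z => t • z) '' zonotope D c := by
  ext z
  simp only [zonotope, Set.mem_image, Set.mem_Icc, exists_exists_and_eq_and]
  constructor
  · rintro ⟨r, ⟨h0, h1⟩, rfl⟩
    refine ⟨t⁻¹ • r, ⟨smul_nonneg (inv_nonneg.2 ht.le) h0, fun i => ?_⟩, ?_⟩
    · have := h1 i
      simp only [Pi.smul_apply, smul_eq_mul] at this ⊢
      rw [inv_mul_le_iff₀ ht]; exact this
    · rw [Finset.smul_sum]
      refine Finset.sum_congr rfl fun i _ => ?_
      rw [smul_smul, Pi.smul_apply, smul_eq_mul, mul_inv_cancel_left₀ ht.ne']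
  · rintro ⟨r, ⟨h0, h1⟩, rfl⟩
    refine ⟨t • r, ⟨smul_nonneg ht.le h0, fun i => ?_⟩, ?_⟩
    · simpa using mul_le_mul_of_nonneg_left (h1 i) ht.le
    · simp [Finset.smul_sum, smul_smul]

variable [DecidableEq E]

/-- Isolates the dependence on one capacity: it makes the volume affine in `c e`, and later exhibits
the overlap with a translate as a zonotope. -/
lemma zonotope_update (D : E → Fin n → ℝ) {c : E → ℝ} (e : E) (t : ℝ) :
    zonotope D (Function.update c e t) =
      sweep (zonotope D (Function.update c e 0)) (D e) t := by
  ext z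
  simp only [zonotope, sweep, Set.mem_image, Set.mem_Icc, Set.mem_ofPred_eq]
  have hsum : ∀ (r : E → ℝ) (a : ℝ), ∑ i, Function.update r e a i • D i =
      ∑ i, r i • D i + (a - r e) • D e := by
    intro r a
    rw [← Finset.add_sum_erase _ _ (Finset.mem_univ e),
      ← Finset.add_sum_erase _ (fun i => r i • D i) (Finset.mem_univ e)]
    rw [Finset.sum_congr rfl (fun i hi => by
      rw [Function.update_of_ne (Finset.ne_of_mem_erase hi)])]
    simp only [Function.update_self]
    module
  constructor
  · rintro ⟨r, ⟨hr0, hr⟩, rfl⟩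
    have hre := hr e
    rw [Function.update_self] at hre
    refine ⟨r e, ⟨hr0 e, hre⟩, Function.update r e 0, ⟨?_, ?_⟩, ?_⟩
    · intro i
      by_cases h : i = e
      · subst h; simp
      · simpa [h] using hr0 i
    · intro i
      by_cases h : i = e
      · subst h; simp
      · simpa [h] using hr i
    · rw [hsum]; module
  · rintro ⟨s, ⟨hs0, hs⟩, r, ⟨hr0, hr⟩, hz⟩
    have hre : r e = 0 := le_antisymm (by simpa using hr e) (hr0 e)
    refine ⟨Function.update r e s, ⟨?_, ?_⟩, ?_⟩
    · intro i
      by_cases h : i = e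
      · subst h; simpa using hs0
      · simpa [h] using hr0 i
    · intro i
      by_cases h : i = e
      · subst h; simpa using hs
      · simpa [h] using hr i
    · rw [hsum, hz, hre]; module

/-- Coordinates outside S are pinned to 0, which leaves a linear image of the unit cube, of volume
|det|. -/
lemma zonotope_indicator (D : E → Fin n → ℝ) (S : Finset E) (σ : Fin n ≃ S) :
    zonotope D (Set.indicator S 1) =
      (Matrix.toLin' (Matrix.of fun j => D (σ j)).transpose) '' Set.Icc 0 1 := by
  have hsum : ∀ r : E → ℝ, (∀ e ∉ S, r e = 0) →
      ∑ e, r e • D e = ∑ j, r (σ j) • D (σ j) := by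
    intro r hr
    rw [Equiv.sum_comp σ (fun e : S => r e • D e), Finset.sum_coe_sort S (fun e => r e • D e)]
    refine (Finset.sum_subset (Finset.subset_univ S) fun e _ he => ?_).symm
    rw [hr e he, zero_smul]
  have hmul : ∀ a : Fin n → ℝ, Matrix.toLin' (Matrix.of fun j => D (σ j)).transpose a =
      ∑ j, a j • D (σ j) := by
    intro a
    ext i
    simp [Matrix.mulVec, dotProduct, Finset.sum_apply, mul_comm]
  ext z
  simp only [zonotope, Set.mem_image, Set.mem_Icc, hmul]
  constructor
  · rintro ⟨r, ⟨h0, h1⟩, rfl⟩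
    refine ⟨fun j => r (σ j), ⟨fun j => h0 _, fun j => ?_⟩, (hsum r fun e he => ?_).symm⟩
    · simpa using h1 (σ j)
    · refine le_antisymm ?_ (h0 e)
      simpa [he] using h1 e
  · rintro ⟨a, ⟨h0, h1⟩, rfl⟩
    refine ⟨fun e => if h : e ∈ S then a (σ.symm ⟨e, h⟩) else 0, ⟨fun e => ?_, fun e => ?_⟩, ?_⟩
    · by_cases h : e ∈ S
      · simpa [h] using h0 _
      · simp [h]
    · by_cases h : e ∈ S
      · simpa [h] using h1 _
      · simp [h]
    · rw [hsum]
      · simp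
      · intro e he; simp [he]

/-- The volume of a zonotope, as a sum over the `n`-element sets of generators; `δ S` is the volume
of the parallelepiped spanned by `S`. -/
theorem volume_zonotope (D : E → Fin n → ℝ) (δ : Finset E → ℝ)
    (hδ : ∀ (S : Finset E) (σ : Fin n ≃ S), |(Matrix.of fun j => D (σ j)).det| = δ S)
    {c : E → ℝ} (hc : 0 ≤ c) :
    volume.real (zonotope D c) =
      ∑ S ∈ (univ : Finset E).powersetCard n, δ S * ∏ e ∈ S, c e := by
  rw [eq_sum_of_multiaffine_of_homogeneous (n := n) (f := fun c => volume.real (zonotope D c))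
    ?_ ?_ hc]
  · refine Finset.sum_congr rfl fun S hS => ?_
    congr 1
    have σ : Fin n ≃ S := (Finset.equivFinOfCardEq (Finset.mem_powersetCard.1 hS).2).symm
    rw [zonotope_indicator D S σ, ← hδ S σ, Measure.real, Measure.addHaar_image_linearMap]
    simp [LinearMap.det_toLin', Real.volume_Icc_pi]
  · intro c hc e t ht
    rw [zonotope_update D e t, zonotope_update D (c := c) e 1,
      volume_sweep (isCompact_zonotope _ _) (convex_zonotope _ _) _ ht]
  · intro c hc t ht
    -- At t = 0 the zonotope is a point. Its volume is 0 if n > 0, while for n = 0 it is the whole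
    -- space, in agreement with 0 ^ 0 = 1.
    rcases ht.eq_or_lt with rfl | ht
    · have h0 : zonotope D ((0 : ℝ) • c) = {0} := by
        simp [zonotope]
      rw [h0]
      rcases Nat.eq_zero_or_pos n with rfl | hn
      · have : ∀ s : Set (Fin 0 → ℝ), s.Nonempty → s = {0} := fun s hs => by
          obtain ⟨x, hx⟩ := hs
          ext y; simp [Subsingleton.elim y x, hx, Subsingleton.elim 0 x]
        rw [this (zonotope D c) ⟨_, 0, ⟨le_rfl, hc⟩, rfl⟩]; simp
      · have : Nonempty (Fin n) := ⟨⟨0, hn⟩⟩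
        rw [zero_pow hn.ne', zero_mul, Measure.real, measure_singleton]; simp
    · rw [zonotope_smul D c ht]
      have := Measure.addHaar_smul (volume : Measure (Fin n → ℝ)) t (zonotope D c)
      rw [← Set.image_smul] at this
      rw [Measure.real, this]
      simp [Measure.real, abs_of_pos (pow_pos ht n), ENNReal.toReal_ofReal (pow_nonneg ht.le n)]

end Zonotope

/-! ### Determinants of weighted Gram matrices -/

section Gram

variable {n : ℕ} {E : Type*}

/-- By the Schur complement this is the determinant of a bordered matrix whose last column is affine
in t. No invertibility of A is needed. -/
lemma det_add_smul_vecMulVec (A : Matrix (Fin n) (Fin n) ℝ) (u v : Fin n → ℝ) :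
    ∃ h : ℝ, ∀ t : ℝ, (A + t • Matrix.vecMulVec u v).det = A.det + t * h := by
  let C : Matrix Unit (Fin n) ℝ := Matrix.replicateRow Unit v
  let B : Matrix (Fin n) Unit ℝ := Matrix.replicateCol Unit u
  let M := Matrix.fromBlocks A B C (1 : Matrix Unit Unit ℝ)
  let w : Fin n ⊕ Unit → ℝ := Sum.elim (-u) 0
  let w₁ : Fin n ⊕ Unit → ℝ := Sum.elim 0 1
  have key : ∀ t : ℝ, (A + t • Matrix.vecMulVec u v).det =
      (M.updateCol (Sum.inr ()) w₁).det + t * (M.updateCol (Sum.inr ()) w).det := by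
    intro t
    have e1 : A + t • Matrix.vecMulVec u v = A - (-t • B) * C := by
      ext i j
      simp [B, C, Matrix.mul_apply, Matrix.vecMulVec_apply]
    rw [e1, ← Matrix.det_fromBlocks_one₂₂, ← Matrix.det_updateCol_smul,
      ← Matrix.det_updateCol_add]
    congr 1
    ext i j
    rcases i with i | i <;> rcases j with j | j <;>
      simp [M, w, w₁, B]
  refine ⟨(M.updateCol (Sum.inr ()) w).det, fun t => ?_⟩
  have h0 := key 0
  simp only [zero_smul, add_zero, zero_mul] at h0
  rw [key, h0]

variable [Fintype E]

/-- The weighted Gram matrix `∑ₑ cₑ Dₑ Dₑᵀ`. -/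
def gram (D : E → Fin n → ℝ) (c : E → ℝ) : Matrix (Fin n) (Fin n) ℝ :=
  ∑ e, c e • Matrix.vecMulVec (D e) (D e)

lemma gram_update [DecidableEq E] (D : E → Fin n → ℝ) (c : E → ℝ) (e : E) (t : ℝ) :
    gram D (Function.update c e t) = gram D c + (t - c e) • Matrix.vecMulVec (D e) (D e) := by
  rw [gram, gram, ← Finset.add_sum_erase _ _ (Finset.mem_univ e),
    ← Finset.add_sum_erase _ (fun i => c i • Matrix.vecMulVec (D i) (D i)) (Finset.mem_univ e),
    Finset.sum_congr rfl (fun i hi => by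
      rw [Function.update_of_ne (Finset.ne_of_mem_erase hi)]), Function.update_self]
  module

lemma gram_mulVec (D : E → Fin n → ℝ) (c : E → ℝ) (ψ : Fin n → ℝ) :
    (gram D c).mulVec ψ = ∑ e, (c e * (D e ⬝ᵥ ψ)) • D e := by
  rw [gram, Matrix.sum_mulVec]
  refine Finset.sum_congr rfl fun e _ => ?_
  rw [Matrix.smul_mulVec, Matrix.vecMulVec_mulVec]
  ext i
  simp
  ring

lemma gram_indicator [DecidableEq E] (D : E → Fin n → ℝ) (S : Finset E) (σ : Fin n ≃ S) :
    gram D (Set.indicator S 1) =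
      (Matrix.of fun j => D (σ j)).transpose * Matrix.of fun j => D (σ j) := by
  have h1 : gram D (Set.indicator S 1) = ∑ e ∈ S, Matrix.vecMulVec (D e) (D e) := by
    rw [gram, ← Finset.sum_subset (Finset.subset_univ S)]
    · exact Finset.sum_congr rfl fun e he => by simp [he]
    · intro e _ he; simp [he]
  rw [h1, ← Finset.sum_coe_sort S (fun e => Matrix.vecMulVec (D e) (D e)), ← Equiv.sum_comp σ]
  ext i j
  simp [Matrix.sum_apply, Matrix.mul_apply, Matrix.vecMulVec_apply]

/-- The determinant of a weighted Gram matrix, as a sum over the `n`-element sets of vectors. -/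
theorem det_gram [DecidableEq E] (D : E → Fin n → ℝ) (δ : Finset E → ℝ)
    (hδ : ∀ (S : Finset E) (σ : Fin n ≃ S), |(Matrix.of fun j => D (σ j)).det| = δ S)
    {c : E → ℝ} (hc : 0 ≤ c) :
    (gram D c).det = ∑ S ∈ (univ : Finset E).powersetCard n, δ S ^ 2 * ∏ e ∈ S, c e := by
  rw [eq_sum_of_multiaffine_of_homogeneous (n := n) (f := fun c => (gram D c).det) ?_ ?_ hc]
  · refine Finset.sum_congr rfl fun S hS => ?_
    have σ : Fin n ≃ S := (Finset.equivFinOfCardEq (Finset.mem_powersetCard.1 hS).2).symm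
    rw [gram_indicator D S σ, ← hδ S σ, Matrix.det_mul, Matrix.det_transpose, sq_abs, sq]
  · intro c hc e t ht
    obtain ⟨h, hh⟩ := det_add_smul_vecMulVec (gram D c) (D e) (D e)
    simp only [gram_update, hh]
    ring
  · intro c hc t ht
    have : gram D (t • c) = t • gram D c := by
      simp [gram, Finset.smul_sum, smul_smul]
    simp only [this, Matrix.det_smul, Fintype.card_fin]

end Gram

/-! ### Placing the vertices; determinants of spanning trees -/

section Representation

variable {V : Type*} {G : SimpleGraph V} {n : ℕ} {o : G.Dart → ℤˣ} {D : G.edgeSet → Fin n → ℝ}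

lemma dartEdge_symm (d : G.Dart) : dartEdge d.symm = dartEdge d :=
  Subtype.ext d.edge_symm

lemma walkDirection_cons {u v w : V} (h : G.Adj u v) (p : G.Walk v w) :
    walkDirection o D (SimpleGraph.Walk.cons h p) =
      ((o ⟨(u, v), h⟩ : ℤ) : ℝ) • D (dartEdge ⟨(u, v), h⟩) + walkDirection o D p := by
  simp [walkDirection]

lemma walkDirection_append {u v w : V} (p : G.Walk u v) (q : G.Walk v w) :
    walkDirection o D (p.append q) = walkDirection o D p + walkDirection o D q := by
  simp [walkDirection, SimpleGraph.Walk.darts_append]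

lemma walkDirection_reverse (ho : IsOrientation o) {u v : V} (p : G.Walk u v) :
    walkDirection o D p.reverse = - walkDirection o D p := by
  induction p with
  | nil => simp [walkDirection]
  | @cons u v w h p ih =>
    rw [SimpleGraph.Walk.reverse_cons, walkDirection_append, ih, walkDirection_cons,
      walkDirection_cons]
    have h1 := ho ⟨(u, v), h⟩
    have h2 := dartEdge_symm (⟨(u, v), h⟩ : G.Dart)
    simp only [SimpleGraph.Dart.symm_mk, Prod.swap_prod_mk] at h1 h2
    rw [h1, h2]
    simp [walkDirection]

/-- The vertices can be placed at an affine basis so that the direction of an edge is the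
difference of its endpoints. -/
def IsPlacement (o : G.Dart → ℤˣ) (D : G.edgeSet → Fin n → ℝ)
    (b : AffineBasis V ℝ (Fin n → ℝ)) : Prop :=
  ∀ d : G.Dart, ((o d : ℤ) : ℝ) • D (dartEdge d) = b d.snd - b d.fst

lemma IsPlacement.walkDirection_eq {b : AffineBasis V ℝ (Fin n → ℝ)} (hb : IsPlacement o D b)
    {u v : V} (p : G.Walk u v) : walkDirection o D p = b v - b u := by
  induction p with
  | nil => simp [walkDirection]
  | @cons u v w h p ih =>
    rw [walkDirection_cons, ih, hb ⟨(u, v), h⟩]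
    simp

lemma eq_or_eq_neg_of_sign (s : ℤˣ) {z w : Fin n → ℝ} (h : ((s : ℤ) : ℝ) • z = w) :
    (s = 1 ∧ z = w) ∨ (s = -1 ∧ z = -w) := by
  rcases Int.units_eq_one_or s with rfl | rfl
  · left; simpa using h
  · right; simp at h; simp [← h]

lemma exists_dart (e : G.edgeSet) : ∃ d : G.Dart, dartEdge d = e := by
  obtain ⟨e, he⟩ := e
  induction e using Sym2.ind with
  | _ u v => exact ⟨⟨(u, v), he⟩, rfl⟩

lemma isSpanningTree_edgeEnds_iff (T : Finset G.edgeSet) :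
    IsSpanningTree (edgeEnds G) T ↔
      (SimpleGraph.fromEdgeSet (Subtype.val '' (T : Set G.edgeSet))).IsTree := by
  refine ⟨fun h => h.2.2, fun h => ⟨fun e _ => G.not_isDiag_of_mem_edgeSet e.2,
    Subtype.val_injective.injOn, h⟩⟩

lemma edgeSet_fromEdgeSet_val (S : Set G.edgeSet) :
    (SimpleGraph.fromEdgeSet (Subtype.val '' S)).edgeSet = Subtype.val '' S := by
  rw [SimpleGraph.edgeSet_fromEdgeSet, sdiff_eq_left, Set.disjoint_left]
  rintro _ ⟨e, _, rfl⟩ hd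
  exact G.not_isDiag_of_mem_edgeSet e.2 hd

lemma IsSpanningTree.card_eq [Fintype V] (hn : Fintype.card V = n + 1) {T : Finset G.edgeSet}
    (hT : IsSpanningTree (edgeEnds G) T) : T.card = n := by
  have h := (SimpleGraph.isTree_iff_connected_and_card.1 ((isSpanningTree_edgeEnds_iff T).1 hT)).2
  rw [edgeSet_fromEdgeSet_val, Nat.card_image_of_injective Subtype.val_injective,
    Nat.card_eq_fintype_card (α := V), hn] at h
  simpa using h

/-- If the edges satisfying `p` connect the graph, they contain a spanning tree. -/
lemma exists_isSpanningTree [Fintype G.edgeSet] {p : G.edgeSet → Prop}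
    (hconn : (SimpleGraph.fromEdgeSet {a : Sym2 V | ∃ e : G.edgeSet, e.1 = a ∧ p e}).Connected) :
    ∃ T : Finset G.edgeSet, IsSpanningTree (edgeEnds G) T ∧ ∀ e ∈ T, p e := by
  classical
  obtain ⟨H, hle, hH⟩ := hconn.exists_isTree_le
  have hle' : ∀ a ∈ H.edgeSet, ∃ e : G.edgeSet, e.1 = a ∧ p e := fun a ha => by
    have := SimpleGraph.edgeSet_subset_edgeSet.2 hle ha
    rw [SimpleGraph.edgeSet_fromEdgeSet] at this
    exact this.1
  refine ⟨univ.filter fun e => e.1 ∈ H.edgeSet, ?_, ?_⟩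
  · rw [isSpanningTree_edgeEnds_iff]
    have : Subtype.val '' ((univ.filter fun e : G.edgeSet => e.1 ∈ H.edgeSet : Finset G.edgeSet) :
        Set G.edgeSet) = H.edgeSet := by
      ext a
      simp only [Set.mem_image, coe_filter, Finset.mem_univ, true_and, Set.mem_ofPred_eq]
      constructor
      · rintro ⟨e, he, rfl⟩; exact he
      · intro ha
        obtain ⟨e, rfl, _⟩ := hle' a ha
        exact ⟨e, ha, rfl⟩
    rw [this, SimpleGraph.fromEdgeSet_edgeSet]
    exact hH
  · intro e he
    obtain ⟨e', h, hp⟩ := hle' e.1 (Finset.mem_filter.1 he).2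
    rwa [Subtype.ext h] at hp

lemma connected_of_connected_fromEdgeSet {p : G.edgeSet → Prop}
    (hconn : (SimpleGraph.fromEdgeSet {a : Sym2 V | ∃ e : G.edgeSet, e.1 = a ∧ p e}).Connected) :
    G.Connected := by
  refine hconn.mono ?_
  rw [SimpleGraph.fromEdgeSet_le]
  rintro _ ⟨⟨e, rfl, _⟩, _⟩
  exact e.2

/-- A vertex is placed at the direction of some walk from a root. The tree edges make these n + 1
points span n dimensions, which forces affine independence. -/
theorem exists_isPlacement [Fintype V] (hn : Fintype.card V = n + 1) (ho : IsOrientation o)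
    (hD : IsSpanningRepresentation o D) (hG : G.Connected)
    {T : Finset G.edgeSet} (hT : IsSpanningTree (edgeEnds G) T) :
    ∃ b : AffineBasis V ℝ (Fin n → ℝ), IsPlacement o D b := by
  have hne : Nonempty V := hG.nonempty
  let r : V := Classical.arbitrary V
  have w : ∀ u, G.Walk r u := fun u => (hG.preconnected r u).some
  let P : V → Fin n → ℝ := fun u => walkDirection o D (w u)
  have hP : ∀ d : G.Dart, ((o d : ℤ) : ℝ) • D (dartEdge d) = P d.snd - P d.fst := by
    intro d
    -- The closed walk along d, back to the root, and out to `d.fst` has direction 0.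
    have h := (hD.1 d.fst d.fst
      (SimpleGraph.Walk.cons d.adj ((w d.snd).reverse.append (w d.fst)))).2 rfl
    rw [walkDirection_cons, walkDirection_append, walkDirection_reverse ho] at h
    have h' : ((o d : ℤ) : ℝ) • D (dartEdge d) +
      (-walkDirection o D (w d.snd) + walkDirection o D (w d.fst)) = 0 := h
    rw [eq_sub_iff_add_eq, ← sub_eq_zero, ← h']
    simp only [P]
    abel
  have hspan : vectorSpan ℝ (Set.range P) = ⊤ := by
    rw [eq_top_iff, ← hD.2 T hT, Submodule.span_le]
    rintro _ ⟨e, _, rfl⟩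
    obtain ⟨d, rfl⟩ := exists_dart e
    have hmem := vsub_mem_vectorSpan ℝ (Set.mem_range_self (f := P) d.snd)
      (Set.mem_range_self (f := P) d.fst)
    rw [vsub_eq_sub] at hmem
    rcases eq_or_eq_neg_of_sign _ (hP d) with ⟨_, h⟩ | ⟨_, h⟩
    · rw [h]; exact hmem
    · rw [h]; exact neg_mem hmem
  refine ⟨⟨P, ?_, ?_⟩, hP⟩
  · rw [affineIndependent_iff_finrank_vectorSpan_eq ℝ P hn, hspan]
    simp
  · rw [AffineSubspace.affineSpan_eq_top_iff_vectorSpan_eq_top_of_nonempty _ _ _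
      (Set.range_nonempty P)]
    exact hspan

/-- Barycentric coordinates turn displacements into incidence at `u`; this serves both for flow
conservation and for cuts. -/
lemma coord_linear_sub [DecidableEq V] (b : AffineBasis V ℝ (Fin n → ℝ)) (u p q : V) :
    (b.coord u).linear (b p - b q) = (if u = p then 1 else 0) - (if u = q then 1 else 0) := by
  rw [← vsub_eq_sub, AffineMap.linearMap_vsub, b.coord_apply, b.coord_apply, vsub_eq_sub]

/-- Along the walk in T joining the endpoints of `e`, the displacements are ±D of tree edges and add
up to ±D e. -/
lemma IsPlacement.mem_span_int {b : AffineBasis V ℝ (Fin n → ℝ)} (hb : IsPlacement o D b)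
    {T : Finset G.edgeSet} (hT : IsSpanningTree (edgeEnds G) T) (e : G.edgeSet) :
    D e ∈ Submodule.span ℤ (D '' (T : Set G.edgeSet)) := by
  have key : ∀ u v : V, b v - b u ∈ Submodule.span ℤ (D '' (T : Set G.edgeSet)) := by
    intro u v
    obtain ⟨p⟩ := hT.2.2.connected.preconnected u v
    induction p with
    | nil => simp
    | @cons u v w h p ih =>
      rw [← sub_add_sub_cancel (b w) (b v) (b u)]
      refine add_mem ih ?_
      obtain ⟨⟨a, ha, haeq⟩, _⟩ := (SimpleGraph.fromEdgeSet_adj _).1 h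
      have hadj : G.Adj u v := by
        rw [← SimpleGraph.mem_edgeSet, ← haeq]; exact a.2
      have hmem : D a ∈ Submodule.span ℤ (D '' (T : Set G.edgeSet)) :=
        Submodule.subset_span ⟨a, ha, rfl⟩
      have hd : dartEdge (⟨(u, v), hadj⟩ : G.Dart) = a := Subtype.ext haeq.symm
      have := hb ⟨(u, v), hadj⟩
      rw [hd] at this
      rcases Int.units_eq_one_or (o ⟨(u, v), hadj⟩) with h1 | h1 <;> rw [h1] at this
      · simp at this; rw [← this]; exact hmem
      · simp at this; rw [← this]; exact neg_mem hmem
  obtain ⟨d, rfl⟩ := exists_dart e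
  rcases eq_or_eq_neg_of_sign _ (hb d) with ⟨_, h⟩ | ⟨_, h⟩
  · rw [h]; exact key _ _
  · rw [h]; exact neg_mem (key _ _)

lemma range_equiv (D : G.edgeSet → Fin n → ℝ) {S : Finset G.edgeSet} (σ : Fin n ≃ S) :
    Set.range (fun j => D (σ j)) = D '' (S : Set G.edgeSet) := by
  ext z
  simp only [Set.mem_range, Set.mem_image]
  constructor
  · rintro ⟨j, rfl⟩; exact ⟨σ j, (σ j).2, rfl⟩
  · rintro ⟨e, he, rfl⟩; exact ⟨σ.symm ⟨e, he⟩, by simp⟩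

lemma det_ne_zero_iff_span {S : Finset G.edgeSet} (σ : Fin n ≃ S) :
    (Matrix.of fun j => D (σ j)).det ≠ 0 ↔
      Submodule.span ℝ (D '' (S : Set G.edgeSet)) = ⊤ := by
  rw [← isUnit_iff_ne_zero, ← Matrix.isUnit_iff_isUnit_det,
    ← Matrix.linearIndependent_rows_iff_isUnit, ← range_equiv D σ]
  constructor
  · intro h
    exact h.span_eq_top_of_card_eq_finrank' (by simp)
  · intro h
    exact linearIndependent_of_top_le_span_of_card_eq_finrank h.ge (by simp)

lemma IsPlacement.exists_int_det {b : AffineBasis V ℝ (Fin n → ℝ)} (hb : IsPlacement o D b)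
    {T S : Finset G.edgeSet} (hT : IsSpanningTree (edgeEnds G) T) (σ : Fin n ≃ T)
    (τ : Fin n ≃ S) :
    ∃ a : ℤ, (Matrix.of fun j => D (τ j)).det = a * (Matrix.of fun j => D (σ j)).det := by
  have h : ∀ i, ∃ A : Fin n → ℤ, ∑ j, A j • D (σ j) = D (τ i) := by
    intro i
    have := hb.mem_span_int hT (τ i)
    rw [← range_equiv D σ] at this
    exact (Submodule.mem_span_range_iff_exists_fun ℤ).1 this
  choose A hA using h
  refine ⟨(Matrix.of A).det, ?_⟩
  have hm : (Matrix.of fun j => D (τ j)) =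
      ((Matrix.of A).map (Int.castRingHom ℝ)) * Matrix.of fun j => D (σ j) := by
    ext i l
    simp [Matrix.mul_apply, ← hA i, Finset.sum_apply]
  rw [hm, Matrix.det_mul]
  congr 1
  exact ((Int.castRingHom ℝ).map_det (Matrix.of A)).symm

/-- A set of edges that does not connect V leaves a cut uncrossed, and the functional of that cut
kills its span. Once connected, n edges on n + 1 vertices form a tree. -/
lemma IsPlacement.isSpanningTree [Fintype V] (hn : Fintype.card V = n + 1)
    {b : AffineBasis V ℝ (Fin n → ℝ)} (hb : IsPlacement o D b) {S : Finset G.edgeSet}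
    (hcard : S.card = n) (hspan : Submodule.span ℝ (D '' (S : Set G.edgeSet)) = ⊤) :
    IsSpanningTree (edgeEnds G) S := by
  classical
  rw [isSpanningTree_edgeEnds_iff]
  set H := SimpleGraph.fromEdgeSet (Subtype.val '' (S : Set G.edgeSet)) with hH
  have hne : Nonempty V := Fintype.card_pos_iff.1 (by omega)
  rw [SimpleGraph.isTree_iff_connected_and_card]
  refine ⟨⟨fun r v => ?_⟩, ?_⟩
  -- The functional of the cut around the component of r: it vanishes on edges within a side and is
  -- ±1 across.
  · let ℓ : (Fin n → ℝ) →ₗ[ℝ] ℝ := ∑ u with H.Reachable r u, (b.coord u).linear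
    have hℓ : ∀ p q, ℓ (b p - b q) =
        (if H.Reachable r p then 1 else 0) - (if H.Reachable r q then 1 else 0) := by
      intro p q
      simp only [ℓ, LinearMap.sum_apply, coord_linear_sub, Finset.sum_sub_distrib,
        Finset.sum_ite_eq', Finset.mem_filter, Finset.mem_univ, true_and]
    have hzero : ℓ = 0 := by
      refine LinearMap.ext_on_range (v := fun e : S => D e) ?_ ?_
      · rw [← hspan]; congr 1; ext z; simp
      · intro e
        obtain ⟨d, hd⟩ := exists_dart e.1
        have hadj : H.Adj d.fst d.snd := by
          rw [hH, SimpleGraph.fromEdgeSet_adj]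
          exact ⟨⟨e.1, e.2, by rw [← hd]; rfl⟩, d.adj.ne⟩
        have hiff : H.Reachable r d.fst ↔ H.Reachable r d.snd :=
          ⟨fun h => h.trans hadj.reachable, fun h => h.trans hadj.reachable.symm⟩
        have h0 : ℓ (b d.snd - b d.fst) = 0 := by rw [hℓ]; simp [hiff]
        rw [← hd]
        rcases eq_or_eq_neg_of_sign _ (hb d) with ⟨_, h⟩ | ⟨_, h⟩ <;> rw [h]
        · rw [h0]; rfl
        · rw [map_neg, h0]; simp
    have := hℓ v r
    rw [hzero] at this
    by_contra hv
    simp [hv] at this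
  · rw [edgeSet_fromEdgeSet_val, Nat.card_image_of_injective Subtype.val_injective,
      Nat.card_eq_fintype_card (α := V), hn]
    simpa using hcard

open Classical in
/-- The parallelepipeds of all spanning trees have the same volume, and all other sets of `n`
edges are degenerate. -/
theorem IsPlacement.exists_volume [Fintype V] (hn : Fintype.card V = n + 1)
    {b : AffineBasis V ℝ (Fin n → ℝ)} (hb : IsPlacement o D b)
    (hD : IsSpanningRepresentation o D) {T : Finset G.edgeSet}
    (hT : IsSpanningTree (edgeEnds G) T) :
    ∃ κ : ℝ, 0 < κ ∧ ∀ (S : Finset G.edgeSet) (σ : Fin n ≃ S),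
      |(Matrix.of fun j => D (σ j)).det| = if IsSpanningTree (edgeEnds G) S then κ else 0 := by
  -- The ratio of the two determinants is a nonzero integer, so of absolute value at least 1;
  -- exchanging the trees gives equality.
  have hle : ∀ {S S' : Finset G.edgeSet} (_ : IsSpanningTree (edgeEnds G) S)
      (_ : IsSpanningTree (edgeEnds G) S') (σ : Fin n ≃ S) (τ : Fin n ≃ S'),
      |(Matrix.of fun j => D (σ j)).det| ≤ |(Matrix.of fun j => D (τ j)).det| := by
    intro S S' hS hS' σ τ
    obtain ⟨a, ha⟩ := hb.exists_int_det hS σ τ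
    have hτ := (det_ne_zero_iff_span τ).2 (hD.2 S' hS')
    have ha0 : a ≠ 0 := by
      rintro rfl
      simp [ha] at hτ
    have h1 : (1 : ℝ) ≤ |(a : ℝ)| := by
      exact_mod_cast Int.one_le_abs ha0
    rw [ha, abs_mul]
    exact le_mul_of_one_le_left (abs_nonneg _) h1
  let σ₀ : Fin n ≃ T := (Finset.equivFinOfCardEq (hT.card_eq hn)).symm
  refine ⟨|(Matrix.of fun j => D (σ₀ j)).det|,
    abs_pos.2 ((det_ne_zero_iff_span σ₀).2 (hD.2 T hT)), fun S σ => ?_⟩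
  split_ifs with hS
  · exact le_antisymm (hle hS hT σ σ₀) (hle hT hS σ₀ σ)
  · rw [abs_eq_zero]
    by_contra hne
    refine hS (hb.isSpanningTree hn ?_ ((det_ne_zero_iff_span σ).1 hne))
    simpa using (Fintype.card_congr σ).symm

end Representation

/-! ### Spanning tree polynomials -/

section TreeGen

variable {V E : Type*} [Fintype E]

open Classical in
lemma sum_isSpanningTree_mem (ends : E → Sym2 V) (y : E → ℝ) (e : E) :
    ∑ T : Finset E with IsSpanningTree ends T ∧ e ∈ T, ∏ a ∈ T, y a =
      y e * treeGenAt ends e y := by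
  rw [treeGenAt, Finset.mul_sum]
  symm
  refine Finset.sum_bij' (fun S _ => insert e S) (fun T _ => T.erase e) ?_ ?_ ?_ ?_ ?_
  · intro S hS
    simp only [Finset.mem_filter, Finset.mem_univ, true_and] at hS ⊢
    exact ⟨hS.2, Finset.mem_insert_self _ _⟩
  · intro T hT
    simp only [Finset.mem_filter, Finset.mem_univ, true_and] at hT ⊢
    exact ⟨Finset.notMem_erase _ _, by rw [Finset.insert_erase hT.2]; exact hT.1⟩
  · intro S hS
    exact Finset.erase_insert (Finset.mem_filter.1 hS).2.1
  · intro T hT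
    exact Finset.insert_erase (Finset.mem_filter.1 hT).2.2
  · intro S hS
    rw [Finset.prod_insert (Finset.mem_filter.1 hS).2.1]

open Classical in
/-- The sum of `∏_{a ∈ T} y_a` over the spanning trees `T` that do not contain `e`. -/
noncomputable def treeGenAvoiding (ends : E → Sym2 V) (e : E) (y : E → ℝ) : ℝ :=
  ∑ T : Finset E with IsSpanningTree ends T ∧ e ∉ T, ∏ a ∈ T, y a

lemma treeGen_eq_add (ends : E → Sym2 V) (y : E → ℝ) (e : E) :
    treeGen ends y = treeGenAvoiding ends e y + y e * treeGenAt ends e y := by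
  classical
  rw [← sum_isSpanningTree_mem, treeGen, treeGenAvoiding,
    ← Finset.sum_filter_not_add_sum_filter _ (fun T : Finset E => e ∈ T), Finset.filter_filter,
    Finset.filter_filter]

lemma treeGenAvoiding_congr {ends : E → Sym2 V} {y y' : E → ℝ} {e : E}
    (h : ∀ a, a ≠ e → y a = y' a) : treeGenAvoiding ends e y = treeGenAvoiding ends e y' := by
  refine Finset.sum_congr rfl fun S hS => Finset.prod_congr rfl fun a ha => h a ?_
  simp only [Finset.mem_filter] at hS
  rintro rfl
  exact hS.2.2 ha

lemma treeGenAt_congr {ends : E → Sym2 V} {y y' : E → ℝ} {e : E}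
    (h : ∀ a, a ≠ e → y a = y' a) : treeGenAt ends e y = treeGenAt ends e y' := by
  refine Finset.sum_congr rfl fun S hS => Finset.prod_congr rfl fun a ha => h a ?_
  simp only [Finset.mem_filter] at hS
  rintro rfl
  exact hS.2.1 ha

/-- Γ is affine in the weight of `e` with slope Γ_e. It is used with the weight lowered by k
(volume) and raised by 1 (resistance). -/
lemma treeGen_update [DecidableEq E] (ends : E → Sym2 V) (y : E → ℝ) (e : E) (t : ℝ) :
    treeGen ends (Function.update y e t) =
      treeGen ends y + (t - y e) * treeGenAt ends e y := by
  have h : ∀ a, a ≠ e → Function.update y e t a = y a := fun a ha => Function.update_of_ne ha _ _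
  rw [treeGen_eq_add ends y e, treeGen_eq_add ends _ e, Function.update_self,
    treeGenAt_congr h, treeGenAvoiding_congr h]
  ring

lemma treeGen_pos {ends : E → Sym2 V} {y : E → ℝ} (hy : ∀ e, 0 ≤ y e) {T : Finset E}
    (hT : IsSpanningTree ends T) (hpos : ∀ e ∈ T, 0 < y e) : 0 < treeGen ends y := by
  classical
  refine Finset.sum_pos' (fun S _ => Finset.prod_nonneg fun e _ => hy e)
    ⟨T, by simpa using hT, Finset.prod_pos hpos⟩

end TreeGen

/-! ### Splitting an edge into two parallel edges -/

section Split

variable {V : Type*} {G : SimpleGraph V}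

lemma isSpanningTree_splitEnds_map (e : G.edgeSet) (S : Finset G.edgeSet) :
    IsSpanningTree (splitEnds G e) (S.map Function.Embedding.some) ↔
      IsSpanningTree (edgeEnds G) S := by
  rw [isSpanningTree_edgeEnds_iff]
  have himg : splitEnds G e '' ((S.map Function.Embedding.some : Finset (Option G.edgeSet)) :
      Set (Option G.edgeSet)) = Subtype.val '' (S : Set G.edgeSet) := by
    rw [Finset.coe_map, Set.image_image]
    rfl
  refine ⟨fun h => himg ▸ h.2.2, fun h => ⟨?_, ?_, himg ▸ h⟩⟩
  · intro a ha
    obtain ⟨a, _, rfl⟩ := Finset.mem_map.1 ha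
    exact G.not_isDiag_of_mem_edgeSet a.2
  · intro a ha a' ha' haa
    obtain ⟨a, _, rfl⟩ := Finset.mem_map.1 ha
    obtain ⟨a', _, rfl⟩ := Finset.mem_map.1 ha'
    exact congrArg some (Subtype.ext haa)

/-- The condition `e ∉ S` reflects that `none` and `some e` are parallel, so no tree contains both.
-/
lemma isSpanningTree_splitEnds_insert [DecidableEq G.edgeSet] [DecidableEq (Option G.edgeSet)]
    (e : G.edgeSet) (S : Finset G.edgeSet) :
    IsSpanningTree (splitEnds G e) (insert none (S.map Function.Embedding.some)) ↔
      e ∉ S ∧ IsSpanningTree (edgeEnds G) (insert e S) := by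
  rw [isSpanningTree_edgeEnds_iff]
  have himg : splitEnds G e ''
      ((insert none (S.map Function.Embedding.some) : Finset (Option G.edgeSet)) :
      Set (Option G.edgeSet)) = Subtype.val '' ((insert e S : Finset G.edgeSet) :
      Set G.edgeSet) := by
    rw [Finset.coe_insert, Finset.coe_insert, Finset.coe_map, Set.image_insert_eq,
      Set.image_insert_eq, Set.image_image]
    rfl
  refine ⟨fun h => ⟨fun he => ?_, himg ▸ h.2.2⟩, fun h => ⟨?_, ?_, himg ▸ h.2⟩⟩
  · have := @h.2.1 none (by simp) (some e) (by simpa using he) rfl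
    simp at this
  · rintro (_ | a) _
    · exact G.not_isDiag_of_mem_edgeSet e.2
    · exact G.not_isDiag_of_mem_edgeSet a.2
  · rintro (_ | a) ha (_ | a') ha' haa
    · rfl
    · have : e = a' := Subtype.ext haa
      subst this
      exact absurd (by simpa using ha') h.1
    · have : a = e := Subtype.ext haa
      subst this
      exact absurd (by simpa using ha) h.1
    · exact congrArg some (Subtype.ext haa)

lemma exists_map_some_of_none_notMem {E : Type*} {S : Finset (Option E)} (hS : none ∉ S) :
    ∃ T : Finset E, T.map Function.Embedding.some = S :=
  ⟨S.eraseNone, by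
    classical
    rw [Finset.map_some_eraseNone, Finset.erase_eq_of_notMem hS]⟩

lemma splitCapacity_some [DecidableEq G.edgeSet] (c : G.edgeSet → ℝ) (e a : G.edgeSet) (k : ℝ) :
    splitCapacity G c e k (some a) = Function.update c e (c e - k) a := by
  by_cases h : a = e
  · subst h; simp [splitCapacity]
  · simp [splitCapacity, h]

variable [Fintype G.edgeSet]

/-- A set completed to a tree by f₁ cannot contain f₂, so the changed capacity never enters. -/
lemma treeGenAt_split (c : G.edgeSet → ℝ) (e : G.edgeSet) (k : ℝ) :
    treeGenAt (splitEnds G e) none (splitCapacity G c e k) = treeGenAt (edgeEnds G) e c := by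
  symm
  refine Finset.sum_bij (fun S _ => S.map Function.Embedding.some) ?_ ?_ ?_ ?_
  · intro S hS
    simp only [Finset.mem_filter, Finset.mem_univ, true_and] at hS ⊢
    exact ⟨by simp, (@isSpanningTree_splitEnds_insert _ _ (_) (_) e S).2 hS⟩
  · intro S _ S' _ h
    exact Finset.map_injective _ h
  · intro S hS
    simp only [Finset.mem_filter, Finset.mem_univ, true_and] at hS
    obtain ⟨T, rfl⟩ := exists_map_some_of_none_notMem hS.1
    refine ⟨T, ?_, rfl⟩
    simp only [Finset.mem_filter, Finset.mem_univ, true_and]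
    exact (@isSpanningTree_splitEnds_insert _ _ (_) (_) e T).1 hS.2
  · intro S hS
    simp only [Finset.mem_filter] at hS
    rw [Finset.prod_map]
    refine Finset.prod_congr rfl fun a ha => ?_
    have : a ≠ e := fun h => hS.2.1 (h ▸ ha)
    simp [splitCapacity, this]

lemma treeGenAvoiding_split [DecidableEq G.edgeSet] (c : G.edgeSet → ℝ) (e : G.edgeSet) (k : ℝ) :
    treeGenAvoiding (splitEnds G e) none (splitCapacity G c e k) =
      treeGen (edgeEnds G) (Function.update c e (c e - k)) := by
  symm
  refine Finset.sum_bij (fun S _ => S.map Function.Embedding.some) ?_ ?_ ?_ ?_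
  · intro S hS
    simp only [Finset.mem_filter, Finset.mem_univ, true_and] at hS ⊢
    exact ⟨(isSpanningTree_splitEnds_map e S).2 hS, by simp⟩
  · intro S _ S' _ h
    exact Finset.map_injective _ h
  · intro S hS
    simp only [Finset.mem_filter, Finset.mem_univ, true_and] at hS
    obtain ⟨T, rfl⟩ := exists_map_some_of_none_notMem hS.2
    refine ⟨T, ?_, rfl⟩
    simp only [Finset.mem_filter, Finset.mem_univ, true_and]
    exact (isSpanningTree_splitEnds_map e T).1 hS.1
  · intro S hS
    rw [Finset.prod_map]
    exact Finset.prod_congr rfl fun a _ => (splitCapacity_some c e a k).symm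

/-- Splitting an edge into two parallel edges keeps the spanning tree generating function. -/
theorem treeGen_split (c : G.edgeSet → ℝ) (e : G.edgeSet) (k : ℝ) :
    treeGen (splitEnds G e) (splitCapacity G c e k) = treeGen (edgeEnds G) c := by
  classical
  rw [treeGen_eq_add _ _ none, treeGenAvoiding_split, treeGenAt_split, treeGen_update]
  simp [splitCapacity]

theorem randomTreeProb_split (c : G.edgeSet → ℝ) (e : G.edgeSet) (k : ℝ) :
    randomTreeProb (splitEnds G e) (splitCapacity G c e k) none =
      k * treeGenAt (edgeEnds G) e c / treeGen (edgeEnds G) c := by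
  classical
  have h := treeGen_split c e k
  rw [treeGen] at h
  rw [randomTreeProb, h, sum_isSpanningTree_mem, treeGenAt_split]
  rfl

end Split

/-! ### Configurations, scores and flows -/

section Configurations

variable {V : Type*} {G : SimpleGraph V} {n : ℕ} {o : G.Dart → ℤˣ} {D : G.edgeSet → Fin n → ℝ}

lemma exists_positive_dart (ho : IsOrientation o) (e : G.edgeSet) :
    ∃ d : G.Dart, dartEdge d = e ∧ o d = 1 := by
  obtain ⟨d, rfl⟩ := exists_dart e
  rcases Int.units_eq_one_or (o d) with h | h
  · exact ⟨d, rfl, h⟩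
  · exact ⟨d.symm, dartEdge_symm d, by rw [ho d, h, neg_neg]⟩

/-- The positively oriented dart of an edge. -/
noncomputable def positiveDart (ho : IsOrientation o) (e : G.edgeSet) : G.Dart :=
  (exists_positive_dart ho e).choose

lemma dartEdge_positiveDart (ho : IsOrientation o) (e : G.edgeSet) :
    dartEdge (positiveDart ho e) = e :=
  (exists_positive_dart ho e).choose_spec.1

lemma sign_positiveDart (ho : IsOrientation o) (e : G.edgeSet) : o (positiveDart ho e) = 1 :=
  (exists_positive_dart ho e).choose_spec.2

lemma positiveDart_dartEdge (ho : IsOrientation o) {d : G.Dart} (hd : o d = 1) :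
    positiveDart ho (dartEdge d) = d := by
  have h : (positiveDart ho (dartEdge d)).edge = d.edge :=
    congrArg Subtype.val (dartEdge_positiveDart ho (dartEdge d))
  rcases (SimpleGraph.dart_edge_eq_iff _ _).1 h with h | h
  · exact h
  · have h1 := sign_positiveDart ho (dartEdge d)
    rw [h, ho d, hd] at h1
    exact absurd h1 (by decide)

variable [Fintype V] [DecidableRel G.Adj]

lemma sum_positive {M : Type*} [AddCommMonoid M] (ho : IsOrientation o) (f : G.Dart → M) :
    ∑ d : G.Dart with o d = 1, f d = ∑ e, f (positiveDart ho e) := by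
  refine Finset.sum_bij' (fun d _ => dartEdge d) (fun e _ => positiveDart ho e)
    (fun _ _ => Finset.mem_univ _) ?_ ?_ ?_ ?_
  · intro e _
    simpa using sign_positiveDart ho e
  · intro d hd
    exact positiveDart_dartEdge ho (Finset.mem_filter.1 hd).2
  · intro e _
    exact dartEdge_positiveDart ho e
  · intro d hd
    rw [positiveDart_dartEdge ho (Finset.mem_filter.1 hd).2]

lemma sum_symm {M : Type*} [AddCommMonoid M] (f : G.Dart → M) :
    ∑ d : G.Dart, f d.symm = ∑ d, f d :=
  Equiv.sum_comp (Function.Involutive.toPerm _ SimpleGraph.Dart.symm_involutive) f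

lemma sum_darts {M : Type*} [AddCommMonoid M] (ho : IsOrientation o) (f : G.Dart → M) :
    ∑ d, f d = ∑ e, (f (positiveDart ho e) + f (positiveDart ho e).symm) := by
  rw [Finset.sum_add_distrib, ← sum_positive ho f, ← sum_positive ho (fun d => f d.symm),
    ← Finset.sum_filter_add_sum_filter_not univ (fun d => o d = 1)]
  congr 1
  refine Finset.sum_bij' (fun d _ => d.symm) (fun d _ => d.symm) ?_ ?_ ?_ ?_ ?_
  · intro d hd
    simp only [Finset.mem_filter, Finset.mem_univ, true_and] at hd ⊢
    rw [ho d, (Int.units_eq_one_or _).resolve_left hd, neg_neg]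
  · intro d hd
    simp only [Finset.mem_filter, Finset.mem_univ, true_and] at hd ⊢
    rw [ho d, hd]
    decide
  all_goals simp

lemma score_eq_sum (ho : IsOrientation o) (w : G.Dart → ℝ) :
    score o D w = ∑ e, w (positiveDart ho e) • D e := by
  rw [score, sum_positive ho (fun d => w d • D (dartEdge d))]
  simp only [dartEdge_positiveDart]

/-- The amounts on positive darts determine a configuration and range freely over [0, c e]. -/
lemma stateSpace_eq_zonotope (ho : IsOrientation o) (c : G.edgeSet → ℝ) :
    stateSpace o D c = zonotope D c := by
  ext z
  simp only [stateSpace, zonotope, Set.mem_image, Set.mem_ofPred_eq, Set.mem_Icc]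
  constructor
  · rintro ⟨w, ⟨hw0, hw⟩, rfl⟩
    refine ⟨fun e => w (positiveDart ho e), ⟨fun e => hw0 _, fun e => ?_⟩,
      (score_eq_sum ho w).symm⟩
    have := hw (positiveDart ho e)
    rw [dartEdge_positiveDart] at this
    linarith [hw0 (positiveDart ho e).symm]
  · rintro ⟨t, ⟨h0, h1⟩, rfl⟩
    refine ⟨fun d => if o d = 1 then t (dartEdge d) else c (dartEdge d) - t (dartEdge d),
      ⟨fun d => ?_, fun d => ?_⟩, ?_⟩
    · dsimp only
      split_ifs
      · exact h0 _
      · linarith [h1 (dartEdge d)]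
    · rcases Int.units_eq_one_or (o d) with h | h
      · simp [ho d, h, dartEdge_symm, show (-1 : ℤˣ) ≠ 1 by decide]
      · simp [ho d, h, dartEdge_symm, show (-1 : ℤˣ) ≠ 1 by decide]
    · rw [score_eq_sum ho]
      simp [sign_positiveDart, dartEdge_positiveDart]

/-- Opposite darts have opposite displacements, so only the net flow on each edge counts. -/
lemma sum_smul_positive (ho : IsOrientation o) {b : AffineBasis V ℝ (Fin n → ℝ)}
    (hb : IsPlacement o D b) (f : G.Dart → ℝ) :
    ∑ d, f d • (b d.snd - b d.fst) =
      ∑ e, (f (positiveDart ho e) - f (positiveDart ho e).symm) • D e := by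
  rw [sum_darts ho]
  refine Finset.sum_congr rfl fun e _ => ?_
  have h := hb (positiveDart ho e)
  rw [sign_positiveDart ho, dartEdge_positiveDart] at h
  simp only [Units.val_one, Int.cast_one, one_smul] at h
  rw [h]
  simp only [SimpleGraph.Dart.symm_toProd, Prod.fst_swap, Prod.snd_swap]
  module

variable [DecidableEq V]

/-- A function on darts is a flow of value `k` from `x` to `y` exactly if its total displacement
is `k` times the displacement from `x` to `y`. -/
lemma flow_iff (b : AffineBasis V ℝ (Fin n → ℝ)) (f : G.Dart → ℝ) (x y : V) (k : ℝ) :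
    ∑ d, f d • (b d.snd - b d.fst) = k • (b y - b x) ↔
      ∀ u : V, ((∑ d : G.Dart with d.fst = u, f d) - ∑ d : G.Dart with d.snd = u, f d) =
        (if u = x then k else 0) - (if u = y then k else 0) := by
  constructor
  · intro h u
    have h' := congrArg (b.coord u).linear h
    simp only [map_sum, map_smul, coord_linear_sub, smul_eq_mul, mul_sub, mul_ite, mul_one,
      mul_zero, Finset.sum_sub_distrib] at h'
    rw [Finset.sum_filter, Finset.sum_filter]
    simp only [eq_comm (b := u)]
    simp only [eq_comm (a := u)] at h' ⊢
    linarith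
  · intro h
    have h1 : ∀ g : G.Dart → V, ∑ d, f d • b (g d) = ∑ u, (∑ d with g d = u, f d) • b u := by
      intro g
      rw [← Finset.sum_fiberwise univ g]
      refine Finset.sum_congr rfl fun u _ => ?_
      rw [Finset.sum_smul]
      refine Finset.sum_congr rfl fun d hd => ?_
      rw [(Finset.mem_filter.1 hd).2]
    simp only [smul_sub, Finset.sum_sub_distrib]
    rw [h1 (fun d => d.snd), h1 (fun d => d.fst), ← Finset.sum_sub_distrib]
    have h2 : ∀ u, (∑ d : G.Dart with d.snd = u, f d) • b u -
        (∑ d : G.Dart with d.fst = u, f d) • b u =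
        (if u = y then k else 0) • b u - (if u = x then k else 0) • b u := by
      intro u
      rw [← sub_smul, ← sub_smul]
      congr 1
      linarith [h u]
    rw [Finset.sum_congr rfl fun u _ => h2 u, Finset.sum_sub_distrib]
    simp only [ite_smul, zero_smul, Finset.sum_ite_eq', Finset.mem_univ, if_true]

/-- A transaction succeeds exactly if it does not lead out of the state space. -/
theorem succeeds_iff (ho : IsOrientation o) {b : AffineBasis V ℝ (Fin n → ℝ)}
    (hb : IsPlacement o D b) {c : G.edgeSet → ℝ} {w : G.Dart → ℝ} (hw : IsConfiguration c w)
    (x y : V) (k : ℝ) :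
    Succeeds w x y k ↔ score o D w - k • (b y - b x) ∈ stateSpace o D c := by
  have hsub : ∀ f : G.Dart → ℝ, ∀ w' : G.Dart → ℝ, (∀ d, f d - f d.symm = w d - w' d) →
      ∑ d, f d • (b d.snd - b d.fst) = score o D w - score o D w' := by
    intro f w' h
    rw [sum_smul_positive ho hb, score_eq_sum ho, score_eq_sum ho, ← Finset.sum_sub_distrib]
    refine Finset.sum_congr rfl fun e _ => ?_
    rw [h, sub_smul]
  constructor
  · rintro ⟨f, hf, hflow⟩
    -- The balances after the payment is carried out along f.
    refine ⟨fun d => w d - f d + f d.symm, ⟨fun d => ?_, fun d => ?_⟩, ?_⟩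
    · linarith [hf d, hf d.symm]
    · rw [← hw.2 d]
      simp only [SimpleGraph.Dart.symm_symm]
      ring
    · rw [← (flow_iff b f x y k).2 hflow, hsub f (fun d => w d - f d + f d.symm)
        (fun d => by ring)]
      abel
  · rintro ⟨w', hw', hscore⟩
    -- The positive part of w - w'. It is at most w because w' ≥ 0, and its net flow is w - w'
    -- because that difference is antisymmetric.
    refine ⟨fun d => max (w d - w' d) 0, fun d => ⟨le_max_right _ _,
      max_le (by linarith [hw'.1 d]) (hw.1 d)⟩, ?_⟩
    rw [← flow_iff b, hsub _ w', hscore]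
    · abel
    · intro d
      have h1 : w d.symm - w' d.symm = -(w d - w' d) := by
        linarith [hw.2 d, hw'.2 d]
      rw [h1]
      rcases le_total 0 (w d - w' d) with h | h
      · rw [max_eq_left h, max_eq_right (by linarith)]; ring
      · rw [max_eq_right h, max_eq_left (by linarith)]; ring

/-- Success depends on the score alone, so no score comes from both a failing and a succeeding
configuration. -/
lemma image_failing (ho : IsOrientation o) {b : AffineBasis V ℝ (Fin n → ℝ)}
    (hb : IsPlacement o D b) (c : G.edgeSet → ℝ) (x y : V) (k : ℝ) :
    score o D '' {w | IsConfiguration c w ∧ ¬ Succeeds w x y k} =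
      stateSpace o D c \ {z | z - k • (b y - b x) ∈ stateSpace o D c} := by
  ext z
  constructor
  · rintro ⟨w, ⟨hw, hfail⟩, rfl⟩
    exact ⟨⟨w, hw, rfl⟩, fun h => hfail ((succeeds_iff ho hb hw x y k).2 h)⟩
  · rintro ⟨⟨w, hw, rfl⟩, h⟩
    exact ⟨w, ⟨hw, fun hs => h ((succeeds_iff ho hb hw x y k).1 hs)⟩, rfl⟩

end Configurations

/-! ### Overlap of the zonotope with its translate -/

section Volume

variable {n : ℕ} {E : Type*} [Fintype E] [DecidableEq E]

lemma volume_zonotope_inter (D : E → Fin n → ℝ) (c : E → ℝ) (e : E) {k : ℝ} (hk : 0 ≤ k)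
    (hke : k ≤ c e) {v : Fin n → ℝ} (hv : v = k • D e ∨ v = -(k • D e)) :
    volume.real (zonotope D c ∩ {z | z - v ∈ zonotope D c}) =
      volume.real (zonotope D (Function.update c e (c e - k))) := by
  have hc : zonotope D c = sweep (zonotope D (Function.update c e 0)) (D e) (c e) := by
    rw [← zonotope_update, Function.update_eq_self]
  have key : volume.real (zonotope D c ∩ {z | z - k • D e ∈ zonotope D c}) =
      volume.real (zonotope D (Function.update c e (c e - k))) := by
    have h := sweep_inter_translate (convex_zonotope D (Function.update c e 0)) (D e) hk hke
    rw [← hc, ← zonotope_update] at h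
    rw [← Set.ofPred_mem_eq (s := zonotope D c), ← Set.ofPred_and]
    simp only [Set.mem_ofPred_eq]
    rw [h, Set.image_add_left, Measure.real, measure_preimage_add, Measure.real]
  rcases hv with rfl | rfl
  · exact key
  · rw [← key]
    -- Reversing the payment only translates the overlap.
    have : zonotope D c ∩ {z | z - -(k • D e) ∈ zonotope D c} =
        (fun z => k • D e + z) ⁻¹' (zonotope D c ∩ {z | z - k • D e ∈ zonotope D c}) := by
      ext z
      simp [and_comm, add_comm]
    rw [this, Measure.real, measure_preimage_add, Measure.real]

end Volume

/-! ### Effective resistance -/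

section Resistance

variable {V : Type*} {G : SimpleGraph V} [Fintype V] [DecidableEq V] [DecidableRel G.Adj]

/-- The Laplacian is a symmetric bilinear form. -/
lemma sum_laplacian_comm (c : G.edgeSet → ℝ) (φ ψ : V → ℝ) :
    ∑ u, ψ u * ∑ d : G.Dart with d.fst = u, c (dartEdge d) * (φ d.fst - φ d.snd) =
      ∑ u, φ u * ∑ d : G.Dart with d.fst = u, c (dartEdge d) * (ψ d.fst - ψ d.snd) := by
  have h : ∀ φ ψ : V → ℝ,
      ∑ u, ψ u * ∑ d : G.Dart with d.fst = u, c (dartEdge d) * (φ d.fst - φ d.snd) =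
      ∑ d : G.Dart, c (dartEdge d) * (ψ d.fst * φ d.fst) -
        ∑ d : G.Dart, c (dartEdge d) * (ψ d.fst * φ d.snd) := by
    intro φ ψ
    rw [← Finset.sum_sub_distrib,
      ← Finset.sum_fiberwise univ (fun d : G.Dart => d.fst) (fun d => _ - _)]
    refine Finset.sum_congr rfl fun u _ => ?_
    rw [Finset.mul_sum]
    refine Finset.sum_congr rfl fun d hd => ?_
    rw [(Finset.mem_filter.1 hd).2]
    ring
  rw [h, h, ← sum_symm (fun d : G.Dart => c (dartEdge d) * (ψ d.fst * φ d.snd))]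
  simp only [dartEdge_symm, SimpleGraph.Dart.symm_toProd, Prod.fst_swap, Prod.snd_swap]
  congr 1 <;> exact Finset.sum_congr rfl fun d _ => by ring

/-- Reciprocity: pairing each potential with the Laplacian of the other gives the two potential
differences. -/
lemma IsEffectiveResistance.unique {c : G.edgeSet → ℝ} {x y : V} {R R' : ℝ}
    (h : IsEffectiveResistance c x y R) (h' : IsEffectiveResistance c x y R') : R = R' := by
  obtain ⟨φ, hφ, rfl⟩ := h
  obtain ⟨ψ, hψ, rfl⟩ := h'
  have := sum_laplacian_comm c φ ψ
  simp only [hφ, hψ] at this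
  simp only [mul_sub, mul_ite, mul_one, mul_zero, Finset.sum_sub_distrib,
    Finset.sum_ite_eq', Finset.mem_univ, if_true] at this
  exact this.symm

variable {n : ℕ} {o : G.Dart → ℤˣ} {D : G.edgeSet → Fin n → ℝ}

/-- A solution of the linear system of the weighted Gram matrix gives the potential. -/
lemma isEffectiveResistance_of_gram (ho : IsOrientation o) {b : AffineBasis V ℝ (Fin n → ℝ)}
    (hb : IsPlacement o D b) (c : G.edgeSet → ℝ) (x y : V) {ψ : Fin n → ℝ}
    (hψ : (gram D c).mulVec ψ = b y - b x) :
    IsEffectiveResistance c x y ((b y - b x) ⬝ᵥ ψ) := by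
  -- The sign makes current run from x down to y, since `D` points from tail to head.
  refine ⟨fun u => -(b u ⬝ᵥ ψ), ?_, ?_⟩
  · let f : G.Dart → ℝ := fun d => c (dartEdge d) * ((b d.snd - b d.fst) ⬝ᵥ ψ)
    have hf : ∀ d : G.Dart,
        c (dartEdge d) * (-(b d.fst ⬝ᵥ ψ) - -(b d.snd ⬝ᵥ ψ)) = f d := by
      intro d
      simp only [f, sub_dotProduct]
      ring
    have hfsymm : ∀ d : G.Dart, f d.symm = - f d := by
      intro d
      simp only [f, dartEdge_symm, SimpleGraph.Dart.symm_toProd, Prod.fst_swap, Prod.snd_swap,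
        sub_dotProduct]
      ring
    have hpos : ∀ e, f (positiveDart ho e) = c e * (D e ⬝ᵥ ψ) := by
      intro e
      have h := hb (positiveDart ho e)
      rw [sign_positiveDart ho, dartEdge_positiveDart] at h
      simp only [Units.val_one, Int.cast_one, one_smul] at h
      simp only [f, dartEdge_positiveDart, h]
    -- Halved because the antisymmetric f counts the current of each edge on both of its darts.
    have hflow := (flow_iff b (fun d => f d / 2) x y 1).1 (by
      rw [sum_smul_positive ho hb, one_smul, ← hψ, gram_mulVec]
      refine Finset.sum_congr rfl fun e _ => ?_
      rw [hfsymm, ← hpos]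
      ring_nf)
    intro u
    rw [← hflow u, Finset.sum_congr rfl fun d _ => hf d]
    have h2 : ∑ d : G.Dart with d.snd = u, f d / 2 =
        - ∑ d : G.Dart with d.fst = u, f d / 2 := by
      rw [Finset.sum_filter, ← sum_symm, Finset.sum_filter, ← Finset.sum_neg_distrib]
      refine Finset.sum_congr rfl fun d _ => ?_
      rw [hfsymm]
      simp only [SimpleGraph.Dart.symm_toProd, Prod.snd_swap]
      split_ifs <;> ring
    rw [h2, ← Finset.sum_div]
    ring
  · simp only [sub_dotProduct]
    ring

end Resistance

/-! ### From n-element edge sets to spanning trees -/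

section Sums

variable {V : Type*} {G : SimpleGraph V} [Fintype V] [Fintype G.edgeSet] {n : ℕ}

open Classical in
lemma sum_powersetCard_eq_treeGen (hn : Fintype.card V = n + 1) (κ : ℝ) (c : G.edgeSet → ℝ) :
    ∑ S ∈ (univ : Finset G.edgeSet).powersetCard n,
      (if IsSpanningTree (edgeEnds G) S then κ else 0) * ∏ e ∈ S, c e =
      κ * treeGen (edgeEnds G) c := by
  simp only [ite_mul, zero_mul]
  rw [treeGen, Finset.mul_sum, ← Finset.sum_filter]
  refine Finset.sum_congr ?_ fun _ _ => rfl
  ext S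
  simp only [Finset.mem_filter, Finset.mem_powersetCard, Finset.mem_univ, true_and,
    Finset.subset_univ, and_iff_right_iff_imp]
  exact fun h => h.card_eq hn

end Sums

/-! ### Failure probability and liquidity -/

section FailureProbability

variable {V : Type*} {G : SimpleGraph V} [Fintype V] [DecidableRel G.Adj]
  {n : ℕ} {o : G.Dart → ℤˣ} {D : G.edgeSet → Fin n → ℝ}

lemma cond_real_apply {Ω : Type*} [MeasurableSpace Ω] (μ : Measure Ω) {s : Set Ω}
    (hs : MeasurableSet s) (t : Set Ω) :
    (ProbabilityTheory.cond μ s).real t = μ.real (s ∩ t) / μ.real s := by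
  rw [Measure.real, ProbabilityTheory.cond_apply hs, ENNReal.toReal_mul, ENNReal.toReal_inv,
    div_eq_inv_mul, Measure.real, Measure.real]

lemma isCompact_stateSpace (ho : IsOrientation o) (c : G.edgeSet → ℝ) :
    IsCompact (stateSpace o D c) := by
  rw [stateSpace_eq_zonotope ho]
  exact isCompact_zonotope D c

lemma isProbabilityMeasure_uniformState (ho : IsOrientation o) {c : G.edgeSet → ℝ}
    (hvol : volume.real (stateSpace o D c) ≠ 0) : IsProbabilityMeasure (uniformState o D c) := by
  refine ProbabilityTheory.cond_isProbabilityMeasure_of_finite (fun h => hvol ?_)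
    (isCompact_stateSpace ho c).measure_ne_top
  rw [Measure.real, h, ENNReal.toReal_zero]

variable [DecidableEq V]

/-- The probability of failure is one minus the liquidity. -/
theorem failureProb_eq_one_sub_liquidity (ho : IsOrientation o)
    {b : AffineBasis V ℝ (Fin n → ℝ)} (hb : IsPlacement o D b) {c : G.edgeSet → ℝ}
    (hvol : volume.real (stateSpace o D c) ≠ 0) (x y : V) (k : ℝ) :
    failureProb o D c x y k = 1 - liquidity o D c (k • (b y - b x)) := by
  have hcomp := isCompact_stateSpace (D := D) ho c
  have hmeas : MeasurableSet {z | z - k • (b y - b x) ∈ stateSpace o D c} :=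
    hcomp.measurableSet.preimage (measurable_id.sub_const _)
  rw [failureProb, liquidity, image_failing ho hb, uniformState,
    cond_real_apply _ hcomp.measurableSet, cond_real_apply _ hcomp.measurableSet,
    Set.inter_eq_self_of_subset_right Set.sdiff_subset, eq_sub_iff_add_eq, ← add_div,
    add_comm, measureReal_inter_add_sdiff hmeas hcomp.measure_ne_top, div_self hvol]

end FailureProbability

end PaymentNetwork

/-! ### The main theorem -/

theorem mainTheorem5 {V : Type*} [Fintype V] [DecidableEq V]
    (G : SimpleGraph V) [DecidableRel G.Adj]
    {n : ℕ} (hn : Fintype.card V = n + 1)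
    (o : G.Dart → ℤˣ) (ho : IsOrientation o)
    (D : G.edgeSet → Fin n → ℝ) (hD : IsSpanningRepresentation o D)
    (c : G.edgeSet → ℝ) (hc : ∀ e, 0 ≤ c e)
    (hconn : (SimpleGraph.fromEdgeSet {a : Sym2 V | ∃ e : G.edgeSet, e.1 = a ∧ 0 < c e}).Connected)
    (x y : V) (e : G.edgeSet) (he : e.1 = s(x, y))
    (k : ℝ) (hk : 0 ≤ k) (hke : k ≤ c e)
    (v : Fin n → ℝ) (hv : CorrespondsTo o D x y k v) :
    MeasureTheory.IsProbabilityMeasure (uniformState o D c) ∧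
    0 < treeGen (edgeEnds G) c ∧
    0 < treeGen (splitEnds G e) (splitCapacity G c e k) ∧
    -- the two descriptions of failure agree
    1 - liquidity o D c v = failureProb o D c x y k ∧
    -- first part, with its expression through the effective resistance
    failureProb o D c x y k = k * treeGenAt (edgeEnds G) e c / treeGen (edgeEnds G) c ∧
    (∃ R : ℝ, (∀ R' : ℝ, IsEffectiveResistance c x y R' ↔ R' = R) ∧
      failureProb o D c x y k = k * R) ∧
    -- second part: `none` is the parallel edge of capacity `k`
    failureProb o D c x y k =
      randomTreeProb (splitEnds G e) (splitCapacity G c e k) none := by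
  classical
  obtain ⟨T, hT, hTpos⟩ := exists_isSpanningTree hconn
  obtain ⟨b, hb⟩ := exists_isPlacement hn ho hD (connected_of_connected_fromEdgeSet hconn) hT
  obtain ⟨κ, hκ, hδ⟩ := hb.exists_volume hn hD hT
  have hΓ : 0 < treeGen (edgeEnds G) c := treeGen_pos hc hT hTpos
  have hvol : ∀ {a : G.edgeSet → ℝ}, 0 ≤ a →
      MeasureTheory.volume.real (zonotope D a) = κ * treeGen (edgeEnds G) a := by
    intro a ha
    rw [volume_zonotope D _ hδ ha, sum_powersetCard_eq_treeGen hn]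
  have hdet : ∀ {a : G.edgeSet → ℝ}, 0 ≤ a →
      (gram D a).det = κ ^ 2 * treeGen (edgeEnds G) a := by
    intro a ha
    rw [det_gram D _ hδ ha, ← sum_powersetCard_eq_treeGen hn]
    refine Finset.sum_congr rfl fun S _ => ?_
    split_ifs <;> simp
  have hupd : ∀ {t : ℝ}, 0 ≤ t → 0 ≤ Function.update c e t := by
    intro t ht a
    by_cases h : a = e
    · subst h; simpa using ht
    · simpa [h] using hc a
  have hvolZ : MeasureTheory.volume.real (stateSpace o D c) = κ * treeGen (edgeEnds G) c := by
    rw [stateSpace_eq_zonotope ho, hvol hc]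
  have hvol0 : MeasureTheory.volume.real (stateSpace o D c) ≠ 0 := by
    rw [hvolZ]; positivity
  have hvb : v = k • (b y - b x) := by
    obtain ⟨p, rfl⟩ := hv
    rw [hb.walkDirection_eq p]
  have hβ : D e = b y - b x ∨ D e = -(b y - b x) := by
    have hadj : G.Adj x y := by rw [← SimpleGraph.mem_edgeSet, ← he]; exact e.2
    have h := hb ⟨(x, y), hadj⟩
    have hd : dartEdge (⟨(x, y), hadj⟩ : G.Dart) = e := Subtype.ext he.symm
    rw [hd] at h
    rcases eq_or_eq_neg_of_sign _ h with ⟨_, h⟩ | ⟨_, h⟩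
    · exact Or.inl h
    · exact Or.inr h
  have hfail := failureProb_eq_one_sub_liquidity ho hb hvol0 x y k
  rw [← hvb] at hfail
  have hliq : liquidity o D c v =
      1 - k * treeGenAt (edgeEnds G) e c / treeGen (edgeEnds G) c := by
    have hvD : v = k • D e ∨ v = -(k • D e) := by
      rw [hvb]
      rcases hβ with h | h
      · exact Or.inl (by rw [h])
      · exact Or.inr (by rw [h, smul_neg, neg_neg])
    have h := volume_zonotope_inter D c e hk hke hvD
    -- The overlap has volume κ(Γ - k Γ_e), and κ cancels in the quotient.
    rw [hvol (hupd (sub_nonneg.2 hke)), treeGen_update] at h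
    rw [liquidity, uniformState, cond_real_apply _ (isCompact_stateSpace ho c).measurableSet,
      hvolZ, stateSpace_eq_zonotope ho, h]
    field_simp
    ring
  have hprob : failureProb o D c x y k =
      k * treeGenAt (edgeEnds G) e c / treeGen (edgeEnds G) c := by
    rw [hfail, hliq]; ring
  refine ⟨isProbabilityMeasure_uniformState ho hvol0, hΓ, ?_, hfail.symm, hprob,
    ⟨treeGenAt (edgeEnds G) e c / treeGen (edgeEnds G) c, fun R' => ?_, ?_⟩, ?_⟩
  · rw [treeGen_split]; exact hΓ
  · have hdet0 : IsUnit (gram D c).det := by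
      rw [hdet hc, isUnit_iff_ne_zero]; positivity
    have hres := isEffectiveResistance_of_gram ho hb c x y
      (ψ := (gram D c)⁻¹.mulVec (b y - b x))
      (by rw [Matrix.mulVec_mulVec, Matrix.mul_nonsing_inv _ hdet0, Matrix.one_mulVec])
    have hR : (b y - b x) ⬝ᵥ (gram D c)⁻¹.mulVec (b y - b x) =
        treeGenAt (edgeEnds G) e c / treeGen (edgeEnds G) c := by
      -- The determinant after raising `c e` by 1 is computed twice: as κ²(Γ + Γ_e), and by the
      -- matrix determinant lemma as κ² Γ (1 + R).
      have h1 := hdet (hupd (add_nonneg (hc e) zero_le_one))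
      have hvec : Matrix.vecMulVec (D e) (D e) =
          Matrix.replicateCol Unit (b y - b x) * Matrix.replicateRow Unit (b y - b x) := by
        rw [← Matrix.vecMulVec_eq]
        rcases hβ with h | h <;> rw [h]
        ext i j
        simp only [Matrix.vecMulVec_apply, Pi.neg_apply, neg_mul_neg]
      rw [gram_update, treeGen_update, add_sub_cancel_left, one_smul, one_mul, hvec,
        Matrix.det_add_replicateCol_mul_replicateRow hdet0, hdet hc] at h1
      have h2 : (1 + Matrix.replicateRow Unit (b y - b x) * (gram D c)⁻¹ *
          Matrix.replicateCol Unit (b y - b x)).det =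
          1 + (b y - b x) ⬝ᵥ (gram D c)⁻¹.mulVec (b y - b x) := by
        rw [Matrix.det_unique, Matrix.mul_assoc]
        simp [Matrix.mul_apply, dotProduct, Matrix.mulVec]
      rw [h2] at h1
      have h3 : κ ^ 2 * (treeGen (edgeEnds G) c *
          ((b y - b x) ⬝ᵥ (gram D c)⁻¹.mulVec (b y - b x))) =
          κ ^ 2 * treeGenAt (edgeEnds G) e c := by linarith
      rw [eq_div_iff hΓ.ne', mul_comm]
      exact mul_left_cancel₀ (by positivity) h3
    rw [hR] at hres
    exact ⟨fun h => h.unique hres, fun h => h ▸ hres⟩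
  · rw [hprob, mul_div_assoc]
  · rw [hprob, randomTreeProb_split]
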